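/- **Converse One-Shot Total Resources.** All Hilbert spaces are finite-dimensional, $|X|$ denotes the dimension of the system $X$, and $\log$ is to base $2$. For sub-normalized states $\rho,\sigma$ (positive semidefinite, trace at most one) let $P(\rho,\sigma)=\sqrt{1-\bar F(\rho,\sigma)^2}$ be the purified distance, where $\bar F(\rho,\sigma)=\|\sqrt\rho\sqrt\sigma\|_1+\sqrt{(1-\mathrm{Tr}\,\rho)(1-\mathrm{Tr}\,\sigma)}$. Let $H_{\min}(X)_\rho=-\inf\{\lambda\in\mathbb R:\rho\le 2^\lambda I\}$ and $H_{\min}^{\epsilon}(X)_\rho=\sup H_{\min}(X)_{\bar\rho}$, the supremum being over all sub-normalized states $\bar\rho$ on $X$ with $P(\rho,\bar\rho)\le\epsilon$. Let $\epsilon_1\in(0,1)$, $\epsilon_2\in(0,1-\epsilon_1)$, and let $\rho^{ABC}$ be a normalized state with a purification $\rho^{ABCR}$. Consider an $M$-message ebit-assisted state redistribution $\Pi$ of $\rho$ with error $\epsilon_1$, that is, the following. Alice holds $AC$, Bob holds $B$, and they share a maximally entangled state $\Phi_K$ on $T_A^{in}T_B^{in}$ of local dimension $K\ge1$ (that is,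 $\log K$ ebits). They exchange $M$ messages $C_1,\dots,C_M$ (finite-dimensional quantum systems), in turn, Alice sending first. Before each message its sender applies an arbitrary isometry from the systems she or he holds to a memory and the message system; after the last message Alice and Bob apply local isometries. At the end Alice holds $A\,T_A^{out}$ and Bob holds $B\,C\,T_B^{out}$, where $T_A^{out}$ and $T_B^{out}$ have dimension $L\ge1$, and further local memories are discarded. The final state $\theta$ on $ABCR\,T_A^{out}T_B^{out}$ satisfies $$P\big(\theta,\ \Phi_L^{T_A^{out}T_B^{out}}\otimes\rho^{ABCR}\big)\le\epsilon_1,$$ where $\Phi_L$ is the maximally entangled state of local dimension $L$. Put $$e(\Pi)=\log K-\log L,\qquad QCC_{A\to B}(\Pi)=\sum_{i\text{ odd}}\log|C_i|,\qquad QCC_{B\to A}(\Pi)=\sum_{i\text{ even}}\log|C_i|.$$ Then, for every $M$, every such $\Pi$ satisfies $$e(\Pi)+QCC_{A\to B}(\Pi)+QCC_{B\to A}(\Pi)\ \ge\ H_{\min}^{\epsilon_2}(BC)_\rho-H_{\min}^{\epsilon_1+\epsilon_2}(B)_\rho .$$ -/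

import Mathlib

open scoped Kronecker MatrixOrder ComplexOrder Matrix

noncomputable section

namespace QSR

/-! Finite-dimensional quantum systems are modelled as `ℂ^a` for a finite index type `a`;
operators are matrices, a composite system is indexed by the product type. All logarithms are
to base two. -/

/-- Sub-normalized states: positive semidefinite operators of trace at most one. -/
def IsSubState {a : Type*} [Fintype a] (ρ : Matrix a a ℂ) : Prop :=
  ρ.PosSemidef ∧ ρ.trace.re ≤ 1

/-- Normalized states: positive semidefinite operators of trace one. -/
def IsState {a : Type*} [Fintype a] (ρ : Matrix a a ℂ) : Prop :=
  ρ.PosSemidef ∧ ρ.trace = 1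

/-- The rank-one operator `|v⟩⟨v|`. -/
def ketbra {a : Type*} (v : a → ℂ) : Matrix a a ℂ :=
  Matrix.vecMulVec v (star v)

/-- Partial trace over the first factor. -/
def traceLeft {a b : Type*} [Fintype a] (ρ : Matrix (a × b) (a × b) ℂ) : Matrix b b ℂ :=
  Matrix.of fun j j' => ∑ i, ρ (i, j) (i, j')

/-- Partial trace over the second factor. -/
def traceRight {a b : Type*} [Fintype b] (ρ : Matrix (a × b) (a × b) ℂ) : Matrix a a ℂ :=
  Matrix.of fun i i' => ∑ j, ρ (i, j) (i', j)

/-! ### Purified distance -/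

section Distance

variable {a : Type*} [Fintype a] [DecidableEq a]

/-- Trace norm `‖M‖₁ = Tr √(M Mᴴ)`. -/
def traceNorm (M : Matrix a a ℂ) : ℝ :=
  (CFC.sqrt (M * Mᴴ)).trace.re

/-- Fidelity `F(ρ, σ) = ‖√ρ √σ‖₁`. -/
def fidelity (ρ σ : Matrix a a ℂ) : ℝ :=
  traceNorm (CFC.sqrt ρ * CFC.sqrt σ)

/-- Generalized fidelity of sub-normalized states. -/
def genFidelity (ρ σ : Matrix a a ℂ) : ℝ :=
  fidelity ρ σ + √((1 - ρ.trace.re) * (1 - σ.trace.re))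

/-- Purified distance of sub-normalized states. -/
def purifiedDist (ρ σ : Matrix a a ℂ) : ℝ :=
  √(1 - genFidelity ρ σ ^ 2)

/-- The ball of sub-normalized states of purified distance at most `ε` from `ρ`. -/
def epsBall (ε : ℝ) (ρ : Matrix a a ℂ) : Set (Matrix a a ℂ) :=
  {ρ' | IsSubState ρ' ∧ purifiedDist ρ ρ' ≤ ε}

/-! ### Entropies -/

/-- Max-relative entropy `D_max(ρ‖σ) = inf {l ∈ ℝ : ρ ≤ 2^l σ}`, with values in `[-∞, ∞]`. -/
def Dmax (ρ σ : Matrix a a ℂ) : EReal :=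
  ⨅ (l : ℝ) (_ : ρ ≤ ((2 : ℝ) ^ l) • σ), (l : EReal)

/-- Conditional min-entropy `H_min(A|B)_ρ = - inf_σ D_max(ρ ‖ I ⊗ σ)`, where `σ` ranges over the
normalized states of `B`. -/
def condMinEntropy {b : Type*} [Fintype b] [DecidableEq b] (ρ : Matrix (a × b) (a × b) ℂ) :
    EReal :=
  - ⨅ (σ : Matrix b b ℂ) (_ : IsState σ), Dmax ρ ((1 : Matrix a a ℂ) ⊗ₖ σ)

/-- Min-entropy `H_min(A)_ρ = - D_max(ρ ‖ I)`: the case of a trivial conditioning system, see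
`minEntropy_eq_condMinEntropy`. -/
def minEntropy (ρ : Matrix a a ℂ) : EReal :=
  - Dmax ρ 1

/-- Smooth min-entropy `H_min^ε(A)_ρ`. -/
def smoothMinEntropy (ε : ℝ) (ρ : Matrix a a ℂ) : EReal :=
  ⨆ ρ' ∈ epsBall ε ρ, minEntropy ρ'

end Distance

theorem minEntropy_eq_condMinEntropy {a : Type*} [DecidableEq a] (ρ : Matrix a a ℂ) :
    minEntropy ρ =
      condMinEntropy (ρ.submatrix Prod.fst Prod.fst : Matrix (a × Unit) (a × Unit) ℂ) := by
  have key : ∀ σ : Matrix Unit Unit ℂ, IsState σ →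
      Dmax (ρ.submatrix Prod.fst Prod.fst : Matrix (a × Unit) (a × Unit) ℂ)
        ((1 : Matrix a a ℂ) ⊗ₖ σ) = Dmax ρ 1 := by
    intro σ hσ
    have h1 : σ = 1 := by
      ext i j
      have := hσ.2
      simpa [Matrix.trace] using this
    subst h1
    have h2 : ∀ l : ℝ, ((ρ.submatrix Prod.fst Prod.fst : Matrix (a × Unit) (a × Unit) ℂ) ≤
        ((2 : ℝ) ^ l) • ((1 : Matrix a a ℂ) ⊗ₖ (1 : Matrix Unit Unit ℂ))) ↔
        ρ ≤ ((2 : ℝ) ^ l) • (1 : Matrix a a ℂ) := by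
      intro l
      rw [Matrix.le_iff, Matrix.le_iff]
      have h3 : ((2 : ℝ) ^ l) • ((1 : Matrix a a ℂ) ⊗ₖ (1 : Matrix Unit Unit ℂ)) -
          (ρ.submatrix Prod.fst Prod.fst : Matrix (a × Unit) (a × Unit) ℂ) =
          (((2 : ℝ) ^ l) • (1 : Matrix a a ℂ) - ρ).submatrix
            (Equiv.prodPUnit a) (Equiv.prodPUnit a) := by
        ext ⟨i, u⟩ ⟨j, v⟩
        simp only [Matrix.sub_apply, Matrix.smul_apply, Matrix.kroneckerMap_apply,
          Matrix.submatrix_apply, Matrix.one_apply_eq, mul_one, Equiv.prodPUnit_apply]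
      rw [h3, Matrix.posSemidef_submatrix_equiv]
    simp only [Dmax, h2]
  have h1 : IsState (1 : Matrix Unit Unit ℂ) :=
    ⟨Matrix.PosSemidef.one, by simp⟩
  rw [minEntropy, condMinEntropy]
  congr 1
  apply le_antisymm
  · exact le_iInf₂ fun σ hσ => (key σ hσ).ge
  · exact (iInf₂_le (1 : Matrix Unit Unit ℂ) h1).trans (key 1 h1).le

/-! ### Interactive protocols -/

/-- `Protocol M x y x' y'` is an `M`-message two-party protocol in which the party who speaks
first holds the register `x`, the other party holds the register `y`, and their output registers
are `x'` and `y'`. All intermediate registers have arbitrary finite dimension and all local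
operations are isometries.

* `send`: the speaker applies an isometry `x → m ⊗ c`, keeps `m` and sends `c`; then the receiver,
  now holding `y ⊗ c`, becomes the speaker of a protocol with one message fewer.
* `finish`: after the last message both parties apply an isometry into their output register and a
  register that is discarded. (For the party who sent the last message this isometry may be
  taken to be the identity, as it can be merged with the preceding one.) -/
inductive Protocol : (M : ℕ) → (x y x' y' : Type) →
    [Fintype x] → [DecidableEq x] → [Fintype y] → [DecidableEq y] →
    [Fintype x'] → [Fintype y'] → Type 1
  | finish {x y x' y' : Type} [Fintype x] [DecidableEq x] [Fintype y] [DecidableEq y]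
      [Fintype x'] [Fintype y'] (d e : ℕ)
      (V : Matrix (x' × Fin d) x ℂ) (hV : Vᴴ * V = 1)
      (W : Matrix (y' × Fin e) y ℂ) (hW : Wᴴ * W = 1) :
      Protocol 0 x y x' y'
  | send {x y x' y' : Type} [Fintype x] [DecidableEq x] [Fintype y] [DecidableEq y]
      [Fintype x'] [Fintype y'] {M : ℕ} (m c : ℕ)
      (V : Matrix (Fin m × Fin c) x ℂ) (hV : Vᴴ * V = 1)
      (next : Protocol M (y × Fin c) (Fin m) y' x') :
      Protocol (M + 1) x y x' y'

/-- The channel implemented by a protocol, applied to an operator on `x ⊗ y ⊗ r`, where `r` is a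
reference system held by neither party: conjugation with the isometries, followed by
the partial trace over the discarded registers. -/
def Protocol.channel {r : Type} [Fintype r] [DecidableEq r] :
    {M : ℕ} → {x y x' y' : Type} →
    [Fintype x] → [DecidableEq x] → [Fintype y] → [DecidableEq y] →
    [Fintype x'] → [Fintype y'] → Protocol M x y x' y' →
    Matrix (x × y × r) (x × y × r) ℂ → Matrix (x' × y' × r) (x' × y' × r) ℂ
  | _, _, _, _, _, _, _, _, _, _, _, @Protocol.finish _ _ _ _ _ _ _ _ _ _ _ _ V _ W _, ω =>
      let U := V ⊗ₖ (W ⊗ₖ (1 : Matrix r r ℂ))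
      Matrix.of fun (i, j, s) (i', j', s') =>
        ∑ k, ∑ l, (U * ω * Uᴴ) ((i, k), (j, l), s) ((i', k), (j', l), s')
  | _, _, _, _, _, _, _, _, _, _, _, @Protocol.send _ y _ _ _ _ _ _ _ _ _ m c V _ next, ω =>
      let U := V ⊗ₖ (1 : Matrix (y × r) (y × r) ℂ)
      let ω' : Matrix ((y × Fin c) × Fin m × r) ((y × Fin c) × Fin m × r) ℂ :=
        (U * ω * Uᴴ).submatrix (fun ((j, k), i, s) => ((i, k), j, s))
          (fun ((j, k), i, s) => ((i, k), j, s))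
      (next.channel ω').submatrix (fun (i, j, s) => (j, i, s)) (fun (i, j, s) => (j, i, s))

/-- The number of qubits sent from the first speaker to the other party, and the
number of qubits sent in the opposite direction: sums of `log |c|` over the messages. -/
def Protocol.commCost : {M : ℕ} → {x y x' y' : Type} →
    [Fintype x] → [DecidableEq x] → [Fintype y] → [DecidableEq y] →
    [Fintype x'] → [Fintype y'] → Protocol M x y x' y' → ℝ × ℝ
  | _, _, _, _, _, _, _, _, _, _, _, @Protocol.finish _ _ _ _ _ _ _ _ _ _ _ _ _ _ _ _ => (0, 0)
  | _, _, _, _, _, _, _, _, _, _, _, @Protocol.send _ _ _ _ _ _ _ _ _ _ _ _ c _ _ next =>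
      (Real.logb 2 c + next.commCost.2, next.commCost.1)

/-! ### State redistribution -/

/-- The maximally entangled state of local dimension `K` (that is, `log K` ebits). -/
def maxEntangled (K : ℕ) : Fin K × Fin K → ℂ :=
  fun (s, t) => if s = t then ((1 / √(K : ℝ) : ℝ) : ℂ) else 0

/-- An `M`-message ebit-assisted redistribution protocol with Alice speaking first: Alice starts
with `A`, `C` and half of a maximally entangled state of local dimension `K`, and Bob with `B` and
the other half; at the end Alice holds `A` and Bob `B`, `C`, and each of them holds half of
a system on which a maximally entangled state of local dimension `L` is to be generated. -/
abbrev RedistProtocol (M : ℕ) (A B C : Type) [Fintype A] [DecidableEq A] [Fintype B]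
    [DecidableEq B] [Fintype C] [DecidableEq C] (K L : ℕ) : Type 1 :=
  Protocol M (A × C × Fin K) (B × Fin K) (A × Fin L) (B × C × Fin L)

section Redistribution

variable {A B C R : Type} [Fintype A] [DecidableEq A] [Fintype B] [DecidableEq B]
  [Fintype C] [DecidableEq C] [Fintype R] [DecidableEq R] {M K L : ℕ}

/-- Communication cost from Alice to Bob, in qubits. -/
def RedistProtocol.qccAB (P : RedistProtocol M A B C K L) : ℝ := (Protocol.commCost P).1

/-- Communication cost from Bob to Alice, in qubits. -/
def RedistProtocol.qccBA (P : RedistProtocol M A B C K L) : ℝ := (Protocol.commCost P).2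

/-- Net entanglement consumption, in ebits. -/
def RedistProtocol.netEnt (_P : RedistProtocol M A B C K L) : ℝ :=
  Real.logb 2 K - Real.logb 2 L

/-- The vector `ψ` is a purification on `ABCR` of the state `ρ` on `ABC`. -/
def IsPurification (ψ : (A × B × C) × R → ℂ) (ρ : Matrix (A × B × C) (A × B × C) ℂ) : Prop :=
  traceRight (ketbra ψ) = ρ

/-- The state `Φ_K ⊗ ψ^{ABCR}` before the protocol, where Alice holds `A`, `C`. -/
def inputState (K : ℕ) (ψ : (A × B × C) × R → ℂ) :
    Matrix ((A × C × Fin K) × (B × Fin K) × R) ((A × C × Fin K) × (B × Fin K) × R) ℂ :=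
  ketbra fun ((i, k, s), (j, t), z) => maxEntangled K (s, t) * ψ ((i, j, k), z)

/-- The ideal state `Φ_L ⊗ ψ^{ABCR}` after the protocol, where Bob holds `B`, `C`. -/
def targetState (L : ℕ) (ψ : (A × B × C) × R → ℂ) :
    Matrix ((A × Fin L) × (B × C × Fin L) × R) ((A × Fin L) × (B × C × Fin L) × R) ℂ :=
  ketbra fun ((i, s), (j, k, t), z) => maxEntangled L (s, t) * ψ ((i, j, k), z)

/-- The protocol `P` is a state redistribution, with error `ε`, of the state purified by `ψ`. -/
def RedistProtocol.IsRedistribution (P : RedistProtocol M A B C K L)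
    (ψ : (A × B × C) × R → ℂ) (ε : ℝ) : Prop :=
  purifiedDist (Protocol.channel P (inputState K ψ)) (targetState L ψ) ≤ ε

end Redistribution

end QSR

end

/-! For a vector `u` shared by two parties and a reference, `‖sndMat u‖ ^ 2` is the largest
eigenvalue of the second party's marginal, that is, 2 to the power of minus its min-entropy;
`fstMat` plays the same role for the first party. Local contractions increase neither quantity, and
a `c`-dimensional system that changes hands increases either by at most a factor `c`
(`norm_sq_stack_le`, `norm_sq_unstack_le`). Hence a vector pulled back through a whole protocol
gains at most the factor 2 to the power of the total communication (`Protocol.exists_dilation`).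

The protocol is therefore run backwards on a smoothed output. Let `σ` be close to `ρ^{BC}` with `σ ≤
2^l`. Uhlmann's theorem (`exists_trace_eq_fidelity`) yields `ψ'` on `ABCR` whose overlap with `ψ` is
the fidelity and whose `BC` marginal is at most `2^l`. Tensoring with `Φ_L` divides this bound by
`L`. A second use of Uhlmann (`exists_attach_of_fidelity`) supplies a vector `χ` on the discarded
registers such that the dilated output is `ε₁`-close to `Φ_L ⊗ ψ ⊗ χ`; by
`one_sub_sq_le_norm_inner_sq` it is `(ε₁ + ε₂)`-close to `Φ_L ⊗ ψ' ⊗ χ`. The adjoint isometries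
carry the latter to the input side with its overlap unchanged, now taken with `Φ_K ⊗ ψ`. Dropping
Bob's half of `Φ_K` costs a factor `K`, and the `B` marginal is a smoothing of `ρ^B` with the
required bound (`RedistProtocol.exists_mem_epsBall`).

Adjoints of isometries may shrink vectors, so the result is only sub-normalized. This is harmless:
the states being smoothed have trace one, where generalized and ordinary fidelity agree. -/

noncomputable section

namespace QSR

/-! ### Square roots and pseudo-inverses of positive semidefinite matrices. -/

section PsdSqrt

variable {a : Type*} [Fintype a] [DecidableEq a]

/-- The positive semidefinite square root, as it occurs in `traceNorm` and `fidelity`. -/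
def psdSqrt (ρ : Matrix a a ℂ) : Matrix a a ℂ := CFC.sqrt ρ

theorem fidelity_eq (ρ σ : Matrix a a ℂ) :
    fidelity ρ σ = traceNorm (psdSqrt ρ * psdSqrt σ) := rfl

theorem posSemidef_psdSqrt (ρ : Matrix a a ℂ) : (psdSqrt ρ).PosSemidef :=
  Matrix.nonneg_iff_posSemidef.1 (CFC.sqrt_nonneg ρ)

theorem conjTranspose_psdSqrt (ρ : Matrix a a ℂ) : (psdSqrt ρ)ᴴ = psdSqrt ρ :=
  (posSemidef_psdSqrt ρ).isHermitian

theorem psdSqrt_mul_self {ρ : Matrix a a ℂ} (hρ : ρ.PosSemidef) : psdSqrt ρ * psdSqrt ρ = ρ :=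
  CFC.sqrt_mul_sqrt_self ρ hρ.nonneg

/-- A positive semidefinite matrix has a commuting Hermitian pseudo-inverse. -/
theorem exists_pseudoInverse {P : Matrix a a ℂ} (hP : P.PosSemidef) :
    ∃ G : Matrix a a ℂ, Gᴴ = G ∧ P * G = G * P ∧ P * G * P = P := by
  have hPs : IsSelfAdjoint P := hP.isHermitian
  have hc : ∀ f : ℝ → ℝ, ContinuousOn f (spectrum ℝ P) := fun f =>
    (Matrix.finite_real_spectrum (A := P)).continuousOn f
  have hid : cfc (fun x : ℝ => x) P = P := cfc_id' ℝ P
  have e : ∀ f g : ℝ → ℝ, cfc f P * cfc g P = cfc (fun x => f x * g x) P := fun f g =>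
    (cfc_mul f g P (hc f) (hc g)).symm
  have e1 : P * cfc (fun x : ℝ => x⁻¹) P = cfc (fun x : ℝ => x * x⁻¹) P := by
    rw [← e (fun x => x), hid]
  have e2 : cfc (fun x : ℝ => x⁻¹) P * P = cfc (fun x : ℝ => x⁻¹ * x) P := by
    rw [← e (fun x => x⁻¹) (fun x => x), hid]
  -- Since `0⁻¹ = 0`, the identity `x * x⁻¹ * x = x` holds at `x = 0` too, so the kernel of `P`
  -- needs no separate treatment.
  refine ⟨cfc (fun x : ℝ => x⁻¹) P, (cfc_predicate (fun x : ℝ => x⁻¹) P : IsSelfAdjoint _), ?_, ?_⟩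
  · rw [e1, e2]
    simp only [mul_comm]
  · have e3 : cfc (fun x : ℝ => x * x⁻¹) P * P = cfc (fun x : ℝ => x * x⁻¹ * x) P := by
      rw [← e (fun x => x * x⁻¹) (fun x => x), hid]
    rw [e1, e3]
    simp only [mul_inv_mul_cancel, hid]

end PsdSqrt

/-! ### Polar decomposition, trace-norm duality and Uhlmann's theorem. -/

section Fidelity

open scoped Matrix.Norms.L2Operator

variable {a b : Type*} [Fintype a] [DecidableEq a] [Fintype b] [DecidableEq b]

theorem norm_sq_eq_norm_mul_conjTranspose (T : Matrix a b ℂ) : ‖T‖ ^ 2 = ‖T * Tᴴ‖ := by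
  have h := Matrix.l2_opNorm_conjTranspose_mul_self Tᴴ
  rw [Matrix.conjTranspose_conjTranspose, Matrix.l2_opNorm_conjTranspose] at h
  rw [h, sq]

omit [DecidableEq a] in
theorem norm_sq_eq_norm_conjTranspose_mul (T : Matrix a b ℂ) : ‖T‖ ^ 2 = ‖Tᴴ * T‖ := by
  rw [Matrix.l2_opNorm_conjTranspose_mul_self, sq]

theorem norm_one_le : ‖(1 : Matrix a a ℂ)‖ ≤ 1 := by
  cases isEmpty_or_nonempty a
  · rw [Subsingleton.elim (1 : Matrix a a ℂ) 0, norm_zero]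
    exact zero_le_one
  · exact norm_one.le

omit [DecidableEq a] in
/-- Isometries are contractions. -/
theorem norm_le_one_of_isometry {V : Matrix a b ℂ} (hV : Vᴴ * V = 1) : ‖V‖ ≤ 1 := by
  have h := norm_sq_eq_norm_conjTranspose_mul V
  rw [hV] at h
  have h1 := norm_one_le (a := b)
  nlinarith [norm_nonneg V]

theorem norm_le_of_le_smul_one {σ : Matrix a a ℂ} (hσ : σ.PosSemidef) {r : ℝ} (hr : 0 ≤ r)
    (h : σ ≤ r • (1 : Matrix a a ℂ)) : ‖σ‖ ≤ r := by
  rw [CStarAlgebra.norm_le_iff_le_algebraMap σ hr hσ.nonneg, Algebra.algebraMap_eq_smul_one]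
  exact h

theorem le_norm_smul_one {σ : Matrix a a ℂ} (hσ : σ.PosSemidef) {r : ℝ} (h : ‖σ‖ ≤ r) :
    σ ≤ r • (1 : Matrix a a ℂ) := by
  rw [← Algebra.algebraMap_eq_smul_one]
  exact (CStarAlgebra.norm_le_iff_le_algebraMap σ ((norm_nonneg _).trans h) hσ.nonneg).1 h

/-- Polar decomposition. -/
theorem exists_polar (N : Matrix a b ℂ) : ∃ U : Matrix a b ℂ, ‖U‖ ≤ 1 ∧
    psdSqrt (N * Nᴴ) * U = N ∧ N * Uᴴ = psdSqrt (N * Nᴴ) := by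
  have hN := Matrix.posSemidef_self_mul_conjTranspose N
  have hP := posSemidef_psdSqrt (N * Nᴴ)
  have hPP := psdSqrt_mul_self hN
  generalize psdSqrt (N * Nᴴ) = P at *
  obtain ⟨G, hGs, hcomm, hPG⟩ := exists_pseudoInverse hP
  have hPh : Pᴴ = P := hP.isHermitian
  have hU1 : N * (G * N)ᴴ = P := by
    rw [Matrix.conjTranspose_mul, ← Matrix.mul_assoc, ← hPP, hGs, Matrix.mul_assoc, hcomm,
      ← Matrix.mul_assoc, hPG]
  have hproj : (G * N) * (G * N)ᴴ = G * P := by rw [Matrix.mul_assoc, hU1]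
  refine ⟨G * N, ?_, ?_, hU1⟩
  -- `G * P` is an orthogonal projection, so its norm equals its own square and is at most 1.
  · have h1 : ‖G * N‖ ^ 2 = ‖G * P‖ := by rw [norm_sq_eq_norm_mul_conjTranspose, hproj]
    have h2 : ‖G * P‖ ^ 2 = ‖G * P‖ := by
      rw [norm_sq_eq_norm_mul_conjTranspose, Matrix.conjTranspose_mul, hPh, hGs, hcomm,
        Matrix.mul_assoc, ← Matrix.mul_assoc P, hPG]
    nlinarith [norm_nonneg (G * N), norm_nonneg (G * P), sq_nonneg (‖G * P‖ - 1)]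
  -- `P * G - 1` annihilates `P`, hence `N * Nᴴ = P * P`, hence `N`.
  · have h : (P * (G * N) - N) * (P * (G * N) - N)ᴴ = 0 := by
      have e : P * (G * N) - N = (P * G - 1) * N := by
        rw [Matrix.sub_mul, Matrix.one_mul, Matrix.mul_assoc]
      rw [e, Matrix.conjTranspose_mul, Matrix.mul_assoc, ← Matrix.mul_assoc N, ← hPP,
        ← Matrix.mul_assoc, ← Matrix.mul_assoc, Matrix.sub_mul, Matrix.one_mul, hPG, sub_self,
        Matrix.zero_mul, Matrix.zero_mul]
    exact sub_eq_zero.1 (Matrix.self_mul_conjTranspose_eq_zero.1 h)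

/-- The trace is the sum of `⟨s i, Z (s i)⟩` over the columns `s i` of `√P`, and Cauchy–Schwarz
bounds each term by `‖s i‖ ^ 2`. -/
theorem norm_trace_mul_le {P : Matrix a a ℂ} (hP : P.PosSemidef) {Z : Matrix a a ℂ}
    (hZ : ‖Z‖ ≤ 1) : ‖(P * Z).trace‖ ≤ P.trace.re := by
  set S := psdSqrt P with hS
  have hSS : S * S = P := psdSqrt_mul_self hP
  have hSh : Sᴴ = S := conjTranspose_psdSqrt P
  let s : a → EuclideanSpace ℂ a := fun i => WithLp.toLp 2 (fun k => S k i)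
  have h1 : (P * Z).trace = ∑ i, inner ℂ (s i) (WithLp.toLp 2 (Z *ᵥ (s i).ofLp)) := by
    have e : (P * Z).trace = (Sᴴ * (Z * S)).trace := by
      rw [← hSS, hSh, Matrix.mul_assoc, Matrix.trace_mul_comm, Matrix.mul_assoc]
    rw [e]
    simp only [Matrix.trace, Matrix.diag, Matrix.mul_apply, Matrix.conjTranspose_apply,
      PiLp.inner_apply, Matrix.mulVec, dotProduct, s, RCLike.inner_apply]
    exact Finset.sum_congr rfl fun i _ => Finset.sum_congr rfl fun k _ => mul_comm _ _
  have h2 : P.trace.re = ∑ i, ‖s i‖ ^ 2 := by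
    rw [← hSS]
    nth_rewrite 1 [← hSh]
    simp [Matrix.trace, Matrix.mul_apply, EuclideanSpace.norm_sq_eq, s, Complex.sq_norm,
      Complex.normSq_apply]
  rw [h1, h2]
  refine (norm_sum_le _ _).trans (Finset.sum_le_sum fun i _ => ?_)
  refine (norm_inner_le_norm _ _).trans ?_
  have := (Matrix.l2_opNorm_mulVec Z (s i)).trans
    (mul_le_of_le_one_left (norm_nonneg _) hZ)
  rw [sq]
  exact mul_le_mul_of_nonneg_left this (norm_nonneg _)

theorem fidelity_nonneg (ρ σ : Matrix a a ℂ) : 0 ≤ fidelity ρ σ :=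
  (Complex.le_def.1 (posSemidef_psdSqrt _).trace_nonneg).1

/-- The polar decomposition of `M` absorbs its unitary-like part into the contraction, which leaves
the positive case. -/
theorem norm_trace_mul_le_traceNorm (M : Matrix a a ℂ) {Z : Matrix a a ℂ} (hZ : ‖Z‖ ≤ 1) :
    ‖(M * Z).trace‖ ≤ traceNorm M := by
  obtain ⟨W, hW, hMW, -⟩ := exists_polar M
  have h : M * Z = psdSqrt (M * Mᴴ) * (W * Z) := by rw [← Matrix.mul_assoc, hMW]
  rw [h]
  refine norm_trace_mul_le (posSemidef_psdSqrt _) ?_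
  exact (Matrix.l2_opNorm_mul _ _).trans (mul_le_one₀ hW (norm_nonneg _) hZ)

/-- One half of Uhlmann's theorem: the overlap of purifications is at most the fidelity. -/
theorem norm_trace_conjTranspose_mul_le_fidelity (X Y : Matrix a b ℂ) :
    ‖(Xᴴ * Y).trace‖ ≤ fidelity (X * Xᴴ) (Y * Yᴴ) := by
  obtain ⟨U, hU, hX, -⟩ := exists_polar X
  obtain ⟨U', hU', hY, -⟩ := exists_polar Y
  have hS := conjTranspose_psdSqrt (X * Xᴴ)
  rw [fidelity_eq]
  generalize psdSqrt (X * Xᴴ) = S at *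
  generalize psdSqrt (Y * Yᴴ) = T at *
  have h1 : (Xᴴ * Y).trace = (S * T * (U' * Uᴴ)).trace := by
    rw [← hX, ← hY, Matrix.conjTranspose_mul, hS, Matrix.mul_assoc, Matrix.trace_mul_comm]
    simp only [Matrix.mul_assoc]
  rw [h1]
  refine norm_trace_mul_le_traceNorm _ ((Matrix.l2_opNorm_mul _ _).trans ?_)
  rw [Matrix.l2_opNorm_conjTranspose]
  exact mul_le_one₀ hU' (norm_nonneg _) hU

/-- The other half of Uhlmann's theorem: the fidelity is attained. -/
theorem exists_trace_eq_fidelity (X : Matrix a b ℂ) (σ : Matrix a a ℂ) :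
    ∃ Z : Matrix a b ℂ, ‖Z‖ ≤ 1 ∧
      (Xᴴ * (psdSqrt σ * Z)).trace = (fidelity (X * Xᴴ) σ : ℂ) := by
  obtain ⟨U, hU, hX, hXU⟩ := exists_polar X
  set M := psdSqrt (X * Xᴴ) * psdSqrt σ with hM
  obtain ⟨W, hW, -, hMW⟩ := exists_polar M
  -- `U` turns `Xᴴ` into `√(X Xᴴ)`, and `Wᴴ` turns `M` into its absolute value, whose trace is the
  -- fidelity.
  refine ⟨Wᴴ * U, (Matrix.l2_opNorm_mul _ _).trans (mul_le_one₀ ?_ (norm_nonneg _) hU), ?_⟩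
  · rwa [Matrix.l2_opNorm_conjTranspose]
  have h1 : U * Xᴴ = psdSqrt (X * Xᴴ) := by
    rw [← conjTranspose_psdSqrt, ← hXU, Matrix.conjTranspose_mul, Matrix.conjTranspose_conjTranspose]
  have h2 : (Xᴴ * (psdSqrt σ * (Wᴴ * U))).trace = (M * Wᴴ).trace := by
    rw [hM, ← h1, ← Matrix.mul_assoc, ← Matrix.mul_assoc, Matrix.trace_mul_comm]
    simp only [Matrix.mul_assoc]
  rw [h2, hMW]
  have h3 := (posSemidef_psdSqrt (M * Mᴴ)).trace_nonneg
  exact Complex.ext rfl (by simpa using (Complex.le_def.1 h3).2.symm)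

theorem norm_psdSqrt_sq {σ : Matrix a a ℂ} (hσ : σ.PosSemidef) : ‖psdSqrt σ‖ ^ 2 = ‖σ‖ := by
  rw [norm_sq_eq_norm_mul_conjTranspose, conjTranspose_psdSqrt, psdSqrt_mul_self hσ]

/-- `Z` is only a contraction, so `√σ Z` need not purify `σ`; this bound keeps the corresponding
vector sub-normalized. -/
theorem trace_psdSqrt_mul_le {σ : Matrix a a ℂ} (hσ : σ.PosSemidef) {Z : Matrix a b ℂ}
    (hZ : ‖Z‖ ≤ 1) :
    ((psdSqrt σ * Z) * (psdSqrt σ * Z)ᴴ).trace.re ≤ σ.trace.re := by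
  have h : ((psdSqrt σ * Z) * (psdSqrt σ * Z)ᴴ).trace = (σ * (Z * Zᴴ)).trace := by
    conv_rhs => rw [← psdSqrt_mul_self hσ, Matrix.mul_assoc, Matrix.trace_mul_comm]
    rw [Matrix.conjTranspose_mul, conjTranspose_psdSqrt]
    simp only [Matrix.mul_assoc]
  rw [h]
  refine (Complex.re_le_norm _).trans (norm_trace_mul_le hσ ?_)
  rw [← norm_sq_eq_norm_mul_conjTranspose]
  exact pow_le_one₀ (norm_nonneg _) hZ

end Fidelity

/-! ### Operator norms under reshaping, tensor products and transposition. -/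

section OperatorNorm

open scoped Matrix.Norms.L2Operator

variable {a b c d : Type*} [Fintype a] [DecidableEq a] [Fintype b] [DecidableEq b]
  [Fintype c] [DecidableEq c] [Fintype d] [DecidableEq d]

omit [DecidableEq a] in
theorem norm_mul_le_of_contraction_left {A : Matrix a b ℂ} (hA : ‖A‖ ≤ 1) (T : Matrix b c ℂ) :
    ‖A * T‖ ≤ ‖T‖ :=
  (Matrix.l2_opNorm_mul A T).trans (mul_le_of_le_one_left (norm_nonneg T) hA)

omit [DecidableEq a] in
theorem norm_mul_le_of_contraction_right (T : Matrix a b ℂ) {A : Matrix b c ℂ} (hA : ‖A‖ ≤ 1) :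
    ‖T * A‖ ≤ ‖T‖ :=
  (Matrix.l2_opNorm_mul T A).trans (mul_le_of_le_one_right (norm_nonneg T) hA)

theorem norm_submatrix_le (T : Matrix a b ℂ) {f : c → a} {g : d → b} (hf : f.Injective)
    (hg : g.Injective) : ‖T.submatrix f g‖ ≤ ‖T‖ := by
  have e : T.submatrix f g =
      (1 : Matrix a a ℂ).submatrix f id * (T * (1 : Matrix b b ℂ).submatrix id g) := by
    ext i j
    simp [Matrix.mul_apply, Matrix.one_apply]
  have h1 : ‖(1 : Matrix a a ℂ).submatrix f id‖ ≤ 1 := by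
    rw [← Matrix.l2_opNorm_conjTranspose]
    refine norm_le_one_of_isometry ?_
    ext i j
    simp [Matrix.mul_apply, Matrix.one_apply, hf.eq_iff]
  have h2 : ‖(1 : Matrix b b ℂ).submatrix id g‖ ≤ 1 := by
    refine norm_le_one_of_isometry ?_
    ext i j
    simp [Matrix.mul_apply, Matrix.one_apply, hg.eq_iff]
  rw [e]
  exact (norm_mul_le_of_contraction_left h1 _).trans (norm_mul_le_of_contraction_right _ h2)

/-- Moving a `c`-dimensional system from the column side to the row side of a matrix increases
the squared operator norm at most by the factor `c`. -/
theorem norm_sq_stack_le {n : ℕ} {T : Matrix (a × Fin n) b ℂ} {R : Matrix a c ℂ}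
    (e : Fin n × b ≃ c) (h : ∀ i k z, T (i, k) z = R i (e (k, z))) :
    ‖T‖ ^ 2 ≤ n * ‖R‖ ^ 2 := by
  let S : Fin n → Matrix a b ℂ := fun k => R.submatrix id fun z => e (k, z)
  have hS : ∀ k, ‖S k‖ ≤ ‖R‖ := fun k => norm_submatrix_le R Function.injective_id
    fun z z' hz => (Prod.mk.inj (e.injective hz)).2
  -- Stacking the slices of `R` vertically adds their Gram matrices, one for each of the `n` values
  -- of `k`.
  have hT : Tᴴ * T = ∑ k, (S k)ᴴ * S k := by
    ext z z'
    simp only [Matrix.mul_apply, Matrix.sum_apply, Matrix.conjTranspose_apply,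
      Fintype.sum_prod_type, h, S, Matrix.submatrix_apply, id]
    exact Finset.sum_comm
  rw [norm_sq_eq_norm_conjTranspose_mul, hT]
  refine (norm_sum_le _ _).trans ((Finset.sum_le_card_nsmul _ _ (‖R‖ ^ 2) fun k _ => ?_).trans ?_)
  · rw [← norm_sq_eq_norm_conjTranspose_mul]
    exact pow_le_pow_left₀ (norm_nonneg _) (hS k) 2
  · simp

/-- Moving a `c`-dimensional system from the row side to the column side of a matrix increases
the squared operator norm at most by the factor `c`. -/
theorem norm_sq_unstack_le {n : ℕ} {T : Matrix (a × Fin n) b ℂ} {R : Matrix a c ℂ}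
    (e : Fin n × b ≃ c) (h : ∀ i k z, T (i, k) z = R i (e (k, z))) :
    ‖R‖ ^ 2 ≤ n * ‖T‖ ^ 2 := by
  let S : Fin n → Matrix a b ℂ := fun k => T.submatrix (fun i => (i, k)) id
  have hS : ∀ k, ‖S k‖ ≤ ‖T‖ := fun k => norm_submatrix_le T
    (fun i i' hi => (Prod.mk.inj hi).1) Function.injective_id
  have hR : R * Rᴴ = ∑ k, S k * (S k)ᴴ := by
    ext i i'
    simp only [Matrix.mul_apply, Matrix.sum_apply, Matrix.conjTranspose_apply,
      h, S, Matrix.submatrix_apply, id]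
    rw [← e.sum_comp, Fintype.sum_prod_type]
  rw [norm_sq_eq_norm_mul_conjTranspose, hR]
  refine (norm_sum_le _ _).trans ((Finset.sum_le_card_nsmul _ _ (‖T‖ ^ 2) fun k _ => ?_).trans ?_)
  · rw [← norm_sq_eq_norm_mul_conjTranspose]
    exact pow_le_pow_left₀ (norm_nonneg _) (hS k) 2
  · simp

/-- With `α = ‖A‖ ^ 2` and `β = ‖B‖ ^ 2`, the difference `αβ 1 - AAᴴ ⊗ BBᴴ` equals `(α 1 - AAᴴ) ⊗ β
1 + AAᴴ ⊗ (β 1 - BBᴴ)`, a sum of positive semidefinite terms. -/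
theorem norm_kronecker_le (A : Matrix a b ℂ) (B : Matrix c d ℂ) : ‖A ⊗ₖ B‖ ≤ ‖A‖ * ‖B‖ := by
  have hA : A * Aᴴ ≤ (‖A‖ ^ 2) • (1 : Matrix a a ℂ) :=
    le_norm_smul_one (Matrix.posSemidef_self_mul_conjTranspose A)
      (norm_sq_eq_norm_mul_conjTranspose A).ge
  have hB : B * Bᴴ ≤ (‖B‖ ^ 2) • (1 : Matrix c c ℂ) :=
    le_norm_smul_one (Matrix.posSemidef_self_mul_conjTranspose B)
      (norm_sq_eq_norm_mul_conjTranspose B).ge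
  have h1 : ((‖B‖ ^ 2) • (1 : Matrix c c ℂ)).PosSemidef :=
    Matrix.PosSemidef.one.smul (sq_nonneg _)
  have h : (A ⊗ₖ B) * (A ⊗ₖ B)ᴴ ≤ (‖A‖ ^ 2 * ‖B‖ ^ 2) • (1 : Matrix (a × c) (a × c) ℂ) := by
    rw [Matrix.le_iff] at hA hB ⊢
    have h2 := (hA.kronecker h1).add
      ((Matrix.posSemidef_self_mul_conjTranspose A).kronecker hB)
    have e : (‖A‖ ^ 2 * ‖B‖ ^ 2) • (1 : Matrix (a × c) (a × c) ℂ) - (A ⊗ₖ B) * (A ⊗ₖ B)ᴴ =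
        ((‖A‖ ^ 2) • (1 : Matrix a a ℂ) - A * Aᴴ) ⊗ₖ ((‖B‖ ^ 2) • (1 : Matrix c c ℂ)) +
          (A * Aᴴ) ⊗ₖ ((‖B‖ ^ 2) • (1 : Matrix c c ℂ) - B * Bᴴ) := by
      rw [Matrix.conjTranspose_kronecker, ← Matrix.mul_kronecker_mul,
        ← Matrix.one_kronecker_one]
      ext ⟨i, k⟩ ⟨i', k'⟩
      simp only [Matrix.add_apply, Matrix.sub_apply, Matrix.smul_apply, Matrix.kroneckerMap_apply,
        Complex.real_smul, Complex.ofReal_mul]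
      ring
    rwa [e]
  have h3 := norm_le_of_le_smul_one (Matrix.posSemidef_self_mul_conjTranspose _)
    (by positivity) h
  rw [← norm_sq_eq_norm_mul_conjTranspose, ← mul_pow] at h3
  exact (pow_le_pow_iff_left₀ (norm_nonneg _) (by positivity) two_ne_zero).1 h3

omit [DecidableEq a] in
/-- The operator norm is at most the Frobenius norm. -/
theorem norm_sq_le_sum (T : Matrix a b ℂ) : ‖T‖ ^ 2 ≤ ∑ i, ∑ j, ‖T i j‖ ^ 2 := by
  have h0 : 0 ≤ ∑ i, ∑ j, ‖T i j‖ ^ 2 := by positivity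
  have h : ‖T‖ ≤ √(∑ i, ∑ j, ‖T i j‖ ^ 2) := by
    rw [Matrix.l2_opNorm_def]
    refine ContinuousLinearMap.opNorm_le_bound _ (Real.sqrt_nonneg _) fun v => ?_
    refine abs_le_of_sq_le_sq' ?_ (by positivity) |>.2
    rw [mul_pow, Real.sq_sqrt h0, EuclideanSpace.norm_sq_eq, Finset.sum_mul]
    refine Finset.sum_le_sum fun i _ => ?_
    have e : ((Matrix.toEuclideanLin T) v).ofLp i =
        inner ℂ (WithLp.toLp 2 (star (T i)) : EuclideanSpace ℂ b) v := by
      simp [Matrix.toLpLin_apply, Matrix.mulVec, dotProduct, PiLp.inner_apply, mul_comm]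
    have e2 : ‖(WithLp.toLp 2 (star (T i)) : EuclideanSpace ℂ b)‖ ^ 2 = ∑ j, ‖T i j‖ ^ 2 := by
      simp [EuclideanSpace.norm_sq_eq]
    rw [← e2, ← mul_pow]
    change ‖((Matrix.toEuclideanLin T) v).ofLp i‖ ^ 2 ≤ _
    rw [e]
    exact pow_le_pow_left₀ (norm_nonneg _) (norm_inner_le_norm _ _) 2
  calc ‖T‖ ^ 2 ≤ √(∑ i, ∑ j, ‖T i j‖ ^ 2) ^ 2 := pow_le_pow_left₀ (norm_nonneg _) h 2
    _ = _ := Real.sq_sqrt h0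

/-- Transposition preserves positive semidefiniteness and sends `T * Tᴴ` to `(Tᵀ)ᴴ * Tᵀ`. -/
theorem norm_transpose_le (T : Matrix a b ℂ) : ‖Tᵀ‖ ≤ ‖T‖ := by
  have h := le_norm_smul_one (Matrix.posSemidef_self_mul_conjTranspose T)
    (norm_sq_eq_norm_mul_conjTranspose T).ge
  have e : (Tᵀ)ᴴ * Tᵀ = (T * Tᴴ)ᵀ := by
    rw [Matrix.transpose_mul]
    rfl
  have h1 : (Tᵀ)ᴴ * Tᵀ ≤ (‖T‖ ^ 2) • (1 : Matrix a a ℂ) := by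
    rw [Matrix.le_iff] at h ⊢
    have := h.transpose
    rwa [Matrix.transpose_sub, Matrix.transpose_smul, Matrix.transpose_one, ← e] at this
  have h2 := norm_le_of_le_smul_one (Matrix.posSemidef_conjTranspose_mul_self _) (sq_nonneg _) h1
  rw [← norm_sq_eq_norm_conjTranspose_mul] at h2
  exact (pow_le_pow_iff_left₀ (norm_nonneg _) (norm_nonneg _) two_ne_zero).1 h2

end OperatorNorm

/-! ### Pulling vectors back through a protocol. -/

section Dilation

open scoped Matrix.Norms.L2Operator

/-- A vector on `x ⊗ y ⊗ r` as an operator into `x`. -/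
def fstMat {x y r : Type*} (u : x × y × r → ℂ) : Matrix x (y × r) ℂ :=
  Matrix.of fun i z => u (i, z)

/-- A vector on `x ⊗ y ⊗ r` as an operator into `y`. -/
def sndMat {x y r : Type*} (u : x × y × r → ℂ) : Matrix y (x × r) ℂ :=
  Matrix.of fun j z => u (z.1, j, z.2)

section Local

variable {x y r x' y' : Type*} [Fintype x] [DecidableEq x] [Fintype y] [DecidableEq y]
  [Fintype r] [DecidableEq r] [Fintype x'] [DecidableEq x'] [Fintype y'] [DecidableEq y']

omit [Fintype x] [DecidableEq x] [Fintype y] [DecidableEq y] [DecidableEq x'] [DecidableEq y'] in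
theorem fstMat_mulVec (A : Matrix x x' ℂ) (B : Matrix y y' ℂ) (t : x' × y' × r → ℂ) :
    fstMat ((A ⊗ₖ (B ⊗ₖ (1 : Matrix r r ℂ))) *ᵥ t) =
      A * (fstMat t * (B ⊗ₖ (1 : Matrix r r ℂ))ᵀ) := by
  ext i z
  simp only [fstMat, Matrix.of_apply, Matrix.mul_apply, Matrix.mulVec, dotProduct,
    Matrix.transpose_apply, Finset.mul_sum]
  rw [Fintype.sum_prod_type]
  refine Finset.sum_congr rfl fun i' _ => Finset.sum_congr rfl fun z' _ => ?_
  rw [Matrix.kroneckerMap_apply]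
  ring

omit [Fintype x] [DecidableEq x] [Fintype y] [DecidableEq y] [DecidableEq x'] [DecidableEq y'] in
theorem sndMat_mulVec (A : Matrix x x' ℂ) (B : Matrix y y' ℂ) (t : x' × y' × r → ℂ) :
    sndMat ((A ⊗ₖ (B ⊗ₖ (1 : Matrix r r ℂ))) *ᵥ t) =
      B * (sndMat t * (A ⊗ₖ (1 : Matrix r r ℂ))ᵀ) := by
  ext j z
  simp only [sndMat, Matrix.of_apply, Matrix.mul_apply, Matrix.mulVec, dotProduct,
    Matrix.transpose_apply, Finset.mul_sum, Fintype.sum_prod_type, Matrix.kroneckerMap_apply]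
  rw [Finset.sum_comm]
  refine Finset.sum_congr rfl fun i' _ => Finset.sum_congr rfl fun j' _ =>
    Finset.sum_congr rfl fun s' _ => ?_
  ring

theorem norm_kronecker_one_le {A : Matrix x x' ℂ} (hA : ‖A‖ ≤ 1) :
    ‖A ⊗ₖ (1 : Matrix r r ℂ)‖ ≤ 1 :=
  (norm_kronecker_le _ _).trans (mul_le_one₀ hA (norm_nonneg _) norm_one_le)

variable {A : Matrix x x' ℂ} (hA : ‖A‖ ≤ 1) {B : Matrix y y' ℂ} (hB : ‖B‖ ≤ 1)
  (t : x' × y' × r → ℂ)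
include hA hB

-- One party's operator multiplies the matrix on the left, the other's on the right, so contractions
-- on both sides cannot increase the norm.
omit [DecidableEq x] in
theorem norm_fstMat_mulVec_le :
    ‖fstMat ((A ⊗ₖ (B ⊗ₖ (1 : Matrix r r ℂ))) *ᵥ t)‖ ≤ ‖fstMat t‖ := by
  rw [fstMat_mulVec]
  exact (norm_mul_le_of_contraction_left hA _).trans
    (norm_mul_le_of_contraction_right _ ((norm_transpose_le _).trans (norm_kronecker_one_le hB)))

omit [DecidableEq y] in
theorem norm_sndMat_mulVec_le :
    ‖sndMat ((A ⊗ₖ (B ⊗ₖ (1 : Matrix r r ℂ))) *ᵥ t)‖ ≤ ‖sndMat t‖ := by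
  rw [sndMat_mulVec]
  exact (norm_mul_le_of_contraction_left hB _).trans
    (norm_mul_le_of_contraction_right _ ((norm_transpose_le _).trans (norm_kronecker_one_le hA)))

theorem norm_mulVec_le :
    ‖(WithLp.toLp 2 ((A ⊗ₖ (B ⊗ₖ (1 : Matrix r r ℂ))) *ᵥ t) : EuclideanSpace ℂ _)‖ ≤
      ‖(WithLp.toLp 2 t : EuclideanSpace ℂ _)‖ :=
  (Matrix.l2_opNorm_mulVec _ (WithLp.toLp 2 t)).trans <| mul_le_of_le_one_left (norm_nonneg _) <|
    (norm_kronecker_le _ _).trans (mul_le_one₀ hA (norm_nonneg _) (norm_kronecker_one_le hB))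

end Local

theorem isometry_kronecker {a b a' b' : Type*} [Fintype a] [Fintype b] [DecidableEq b]
    [Fintype a'] [Fintype b'] [DecidableEq b'] {V : Matrix a b ℂ} {W : Matrix a' b' ℂ}
    (hV : Vᴴ * V = 1) (hW : Wᴴ * W = 1) : (V ⊗ₖ W)ᴴ * (V ⊗ₖ W) = 1 := by
  rw [Matrix.conjTranspose_kronecker, ← Matrix.mul_kronecker_mul, hV, hW, Matrix.one_kronecker_one]

theorem mul_ketbra_mul {a b : Type*} [Fintype b] (U : Matrix a b ℂ) (v : b → ℂ) :
    U * ketbra v * Uᴴ = ketbra (U *ᵥ v) := by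
  rw [ketbra, ketbra, Matrix.mul_vecMulVec, Matrix.vecMulVec_mul, Matrix.star_mulVec]

theorem star_mulVec_dotProduct {a b : Type*} [Fintype a] [Fintype b] (U : Matrix a b ℂ)
    (v : b → ℂ) (w : a → ℂ) : star (U *ᵥ v) ⬝ᵥ w = star v ⬝ᵥ (Uᴴ *ᵥ w) := by
  rw [Matrix.star_mulVec, Matrix.dotProduct_mulVec]

theorem star_comp_dotProduct {a b : Type*} [Fintype a] [Fintype b] (e : a ≃ b) (u : b → ℂ)
    (v : a → ℂ) : star (u ∘ e) ⬝ᵥ v = star u ⬝ᵥ (v ∘ e.symm) :=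
  Fintype.sum_equiv e _ _ fun z => by simp

/-- Partial trace over the registers that the two parties discard. -/
def discard {x y d e r : Type*} [Fintype d] [Fintype e]
    (ω : Matrix ((x × d) × (y × e) × r) ((x × d) × (y × e) × r) ℂ) :
    Matrix (x × y × r) (x × y × r) ℂ :=
  Matrix.of fun (i, j, s) (i', j', s') => ∑ k, ∑ l, ω ((i, k), (j, l), s) ((i', k), (j', l), s')

/-- A protocol applied to a pure state is a partial trace of a pure state `Ω'` on a larger system.
A vector that overlaps with `Ω'` can be pulled back through the protocol with the same overlap;
the operator norms of its two local operators grow at most by the total communication. -/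
theorem Protocol.exists_dilation {r : Type} [Fintype r] [DecidableEq r] {M : ℕ}
    {x y x' y' : Type} [Fintype x] [DecidableEq x] [Fintype y] [DecidableEq y]
    [Fintype x'] [Fintype y'] (P : Protocol M x y x' y') :
    ∀ [DecidableEq x'] [DecidableEq y'] (Ω : x × y × r → ℂ),
    ∃ (d e : ℕ) (Ω' : (x' × Fin d) × (y' × Fin e) × r → ℂ),
      P.channel (ketbra Ω) = discard (ketbra Ω') ∧ star Ω' ⬝ᵥ Ω' = star Ω ⬝ᵥ Ω ∧
      ∀ t, star Ω' ⬝ᵥ t ≠ 0 → ∃ t₀ : x × y × r → ℂ, star Ω ⬝ᵥ t₀ = star Ω' ⬝ᵥ t ∧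
        ‖(WithLp.toLp 2 t₀ : EuclideanSpace ℂ _)‖ ≤ ‖(WithLp.toLp 2 t : EuclideanSpace ℂ _)‖ ∧
        ‖fstMat t₀‖ ^ 2 ≤ (2 : ℝ) ^ (P.commCost.1 + P.commCost.2) * ‖fstMat t‖ ^ 2 ∧
        ‖sndMat t₀‖ ^ 2 ≤ (2 : ℝ) ^ (P.commCost.1 + P.commCost.2) * ‖sndMat t‖ ^ 2 := by
  induction P with
  | @finish x y x' y' _ _ _ _ _ _ d e V hV W hW =>
    intro _ _ Ω
    have hU := isometry_kronecker hV (isometry_kronecker hW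
      (show (1 : Matrix r r ℂ)ᴴ * 1 = 1 by simp))
    have hUt : (V ⊗ₖ (W ⊗ₖ (1 : Matrix r r ℂ)))ᴴ = Vᴴ ⊗ₖ (Wᴴ ⊗ₖ (1 : Matrix r r ℂ)) := by
      rw [Matrix.conjTranspose_kronecker, Matrix.conjTranspose_kronecker,
        Matrix.conjTranspose_one]
    have hV1 : ‖Vᴴ‖ ≤ 1 := (Matrix.l2_opNorm_conjTranspose V).trans_le (norm_le_one_of_isometry hV)
    have hW1 : ‖Wᴴ‖ ≤ 1 := (Matrix.l2_opNorm_conjTranspose W).trans_le (norm_le_one_of_isometry hW)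
    refine ⟨d, e, (V ⊗ₖ (W ⊗ₖ (1 : Matrix r r ℂ))) *ᵥ Ω, ?_, ?_, fun t _ =>
      ⟨(V ⊗ₖ (W ⊗ₖ (1 : Matrix r r ℂ)))ᴴ *ᵥ t, (star_mulVec_dotProduct _ _ _).symm, ?_, ?_, ?_⟩⟩
    · rw [← mul_ketbra_mul]
      rfl
    · rw [star_mulVec_dotProduct, Matrix.mulVec_mulVec, hU, Matrix.one_mulVec]
    · rw [hUt]
      exact norm_mulVec_le hV1 hW1 t
    · rw [hUt]
      simp only [Protocol.commCost, add_zero, Real.rpow_zero, one_mul]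
      exact pow_le_pow_left₀ (norm_nonneg _) (norm_fstMat_mulVec_le hV1 hW1 t) 2
    · rw [hUt]
      simp only [Protocol.commCost, add_zero, Real.rpow_zero, one_mul]
      exact pow_le_pow_left₀ (norm_nonneg _) (norm_sndMat_mulVec_le hV1 hW1 t) 2
  | @send x y x' y' _ _ _ _ _ _ M m c V hV next ih =>
    intro _ _ Ω
    set U := V ⊗ₖ (1 : Matrix (y × r) (y × r) ℂ) with hUdef
    have hU : Uᴴ * U = 1 := isometry_kronecker hV (by simp)
    let σ : (y × Fin c) × Fin m × r ≃ (Fin m × Fin c) × y × r :=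
      { toFun := fun ((j, k), i, s) => ((i, k), j, s)
        invFun := fun ((i, k), j, s) => ((j, k), i, s)
        left_inv := fun _ => rfl
        right_inv := fun _ => rfl }
    -- The receiver speaks first in `next`, which interchanges the parties and thus `fstMat` and
    -- `sndMat`; this is why the induction carries both bounds.
    obtain ⟨e, d, Ω', hch, hn, ht⟩ := ih ((U *ᵥ Ω) ∘ σ)
    let τ : (x' × Fin d) × (y' × Fin e) × r ≃ (y' × Fin e) × (x' × Fin d) × r :=
      { toFun := fun (i, j, s) => (j, i, s)
        invFun := fun (j, i, s) => (i, j, s)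
        left_inv := fun _ => rfl
        right_inv := fun _ => rfl }
    have hUt : Uᴴ = Vᴴ ⊗ₖ ((1 : Matrix y y ℂ) ⊗ₖ (1 : Matrix r r ℂ)) := by
      rw [hUdef, Matrix.conjTranspose_kronecker, Matrix.conjTranspose_one,
        Matrix.one_kronecker_one]
    have hV1 : ‖Vᴴ‖ ≤ 1 := (Matrix.l2_opNorm_conjTranspose V).trans_le (norm_le_one_of_isometry hV)
    refine ⟨d, e, Ω' ∘ τ, ?_, ?_, fun t htne => ?_⟩
    · have h1 : Protocol.channel (.send m c V hV next) (ketbra Ω) =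
          (next.channel (ketbra ((U *ᵥ Ω) ∘ σ))).submatrix (fun (i, j, s) => (j, i, s))
            (fun (i, j, s) => (j, i, s)) := by
        have : ketbra ((U *ᵥ Ω) ∘ σ) = (U * ketbra Ω * Uᴴ).submatrix σ σ := by
          rw [mul_ketbra_mul]
          rfl
        rw [this]
        rfl
      rw [h1, hch]
      ext ⟨i, j, s⟩ ⟨i', j', s'⟩
      change ∑ k, ∑ l, ketbra Ω' ((j, k), (i, l), s) ((j', k), (i', l), s') =
        ∑ l, ∑ k, ketbra Ω' ((j, k), (i, l), s) ((j', k), (i', l), s')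
      exact Finset.sum_comm
    · rw [star_comp_dotProduct, Function.comp_assoc, Equiv.self_comp_symm, Function.comp_id, hn,
        star_comp_dotProduct, Function.comp_assoc, Equiv.self_comp_symm, Function.comp_id,
        star_mulVec_dotProduct, Matrix.mulVec_mulVec, hU, Matrix.one_mulVec]
    · have hov : star (Ω' ∘ τ) ⬝ᵥ t = star Ω' ⬝ᵥ (t ∘ τ.symm) := star_comp_dotProduct τ Ω' t
      obtain ⟨t₁, h1, h2, h3, h4⟩ := ht (t ∘ τ.symm) (hov ▸ htne)
      have hov2 : star ((U *ᵥ Ω) ∘ σ) ⬝ᵥ t₁ = star Ω ⬝ᵥ (Uᴴ *ᵥ (t₁ ∘ σ.symm)) := by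
        rw [← star_mulVec_dotProduct, star_comp_dotProduct]
      -- `Real.logb 2 0 = 0` would make `hcost` false for `c = 0`. In that case the index type of
      -- `t₁` is empty, which contradicts the nonzero overlap.
      have hc : 0 < c := by
        rcases Nat.eq_zero_or_pos c with rfl | hc
        · refine absurd ?_ htne
          rw [hov, ← h1]
          exact Finset.sum_eq_zero fun z _ => z.1.2.elim0
        · exact hc
      have hcost : (2 : ℝ) ^ ((Protocol.send m c V hV next).commCost.1 +
          (Protocol.send m c V hV next).commCost.2) =
            c * (2 : ℝ) ^ (next.commCost.1 + next.commCost.2) := by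
        have e : (Protocol.send m c V hV next).commCost.1 +
            (Protocol.send m c V hV next).commCost.2 =
            Real.logb 2 c + (next.commCost.1 + next.commCost.2) := by
          simp only [Protocol.commCost]
          ring
        rw [e, Real.rpow_add two_pos, Real.rpow_logb two_pos (by norm_num) (by exact_mod_cast hc)]
      have hn1 : ‖(WithLp.toLp 2 (t₁ ∘ σ.symm) : EuclideanSpace ℂ _)‖ =
          ‖(WithLp.toLp 2 t₁ : EuclideanSpace ℂ _)‖ := by
        rw [EuclideanSpace.norm_eq, EuclideanSpace.norm_eq]
        exact congrArg _ (σ.symm.sum_comp fun z => ‖t₁ z‖ ^ 2)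
      have hn2 : ‖(WithLp.toLp 2 (t ∘ τ.symm) : EuclideanSpace ℂ _)‖ =
          ‖(WithLp.toLp 2 t : EuclideanSpace ℂ _)‖ := by
        rw [EuclideanSpace.norm_eq, EuclideanSpace.norm_eq]
        exact congrArg _ (τ.symm.sum_comp fun z => ‖t z‖ ^ 2)
      -- Undoing the message returns the system `c` to the speaker's rows and removes it from the
      -- receiver's; each move costs a factor `c`.
      have hfst : ‖fstMat (t₁ ∘ σ.symm)‖ ^ 2 ≤ c * ‖sndMat t₁‖ ^ 2 :=
        norm_sq_stack_le (T := fstMat (t₁ ∘ σ.symm)) (R := sndMat t₁)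
          { toFun := fun (k, j, s) => ((j, k), s)
            invFun := fun ((j, k), s) => (k, j, s)
            left_inv := fun _ => rfl
            right_inv := fun _ => rfl } fun _ _ _ => rfl
      have hsnd : ‖sndMat (t₁ ∘ σ.symm)‖ ^ 2 ≤ c * ‖fstMat t₁‖ ^ 2 :=
        norm_sq_unstack_le (T := fstMat t₁) (R := sndMat (t₁ ∘ σ.symm))
          { toFun := fun (k, i, s) => ((i, k), s)
            invFun := fun ((i, k), s) => (k, i, s)
            left_inv := fun _ => rfl
            right_inv := fun _ => rfl } fun _ _ _ => rfl
      refine ⟨Uᴴ *ᵥ (t₁ ∘ σ.symm), ?_, ?_, ?_, ?_⟩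
      · rw [← hov2, h1, hov]
      · rw [hUt]
        exact (norm_mulVec_le hV1 norm_one_le _).trans (hn1.trans_le (h2.trans_eq hn2))
      · rw [hUt, hcost, mul_assoc]
        exact (pow_le_pow_left₀ (norm_nonneg _) (norm_fstMat_mulVec_le hV1 norm_one_le _) 2).trans
          (hfst.trans (mul_le_mul_of_nonneg_left h4 (Nat.cast_nonneg c)))
      · rw [hUt, hcost, mul_assoc]
        exact (pow_le_pow_left₀ (norm_nonneg _) (norm_sndMat_mulVec_le hV1 norm_one_le _) 2).trans
          (hsnd.trans (mul_le_mul_of_nonneg_left h3 (Nat.cast_nonneg c)))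

end Dilation

/-! ### The triangle inequality at the level of vectors. -/

/-- Triangle inequality for the purified distance of vectors `u`, `v` via a unit vector `w`. -/
theorem one_sub_sq_le_norm_inner_sq {E : Type*} [NormedAddCommGroup E] [InnerProductSpace ℂ E]
    {u v w : E} (hw : ‖w‖ = 1) (hu : ‖u‖ ≤ 1) (hv : ‖v‖ ≤ 1) {ε₁ ε₂ : ℝ} (h₁ : 0 ≤ ε₁)
    (h₂ : 0 ≤ ε₂) (h : ε₁ + ε₂ ≤ 1) (hwu : 1 - ε₁ ^ 2 ≤ ‖inner ℂ w u‖ ^ 2)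
    (hwv : 1 - ε₂ ^ 2 ≤ ‖inner ℂ w v‖ ^ 2) :
    1 - (ε₁ + ε₂) ^ 2 ≤ ‖inner ℂ u v‖ ^ 2 := by
  have hww : inner ℂ w w = (1 : ℂ) := by
    rw [inner_self_eq_norm_sq_to_K, hw]
    simp
  have horth : ∀ z : E, inner ℂ w (z - inner ℂ w z • w) = (0 : ℂ) := fun z => by
    rw [inner_sub_right, inner_smul_right, hww, mul_one, sub_self]
  have hperp : ∀ (z : E) (ε : ℝ), 0 ≤ ε → ‖z‖ ≤ 1 → 1 - ε ^ 2 ≤ ‖inner ℂ w z‖ ^ 2 →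
      ‖z - inner ℂ w z • w‖ ≤ ε := by
    intro z ε hε hz hwz
    have e := norm_add_sq_eq_norm_sq_add_norm_sq_of_inner_eq_zero (inner ℂ w z • w)
      (z - inner ℂ w z • w) (𝕜 := ℂ) (by rw [inner_smul_left, horth, mul_zero])
    rw [add_sub_cancel, norm_smul, hw, mul_one] at e
    nlinarith [norm_nonneg z, norm_nonneg (z - inner ℂ w z • w)]
  -- Split `u` and `v` along `w`: the components orthogonal to `w` have norms at most `ε₁` and `ε₂`.
  have hdec : inner ℂ u v = inner ℂ u w * inner ℂ w v +
      inner ℂ (u - inner ℂ w u • w) (v - inner ℂ w v • w) := by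
    rw [inner_sub_left, inner_smul_left, horth, mul_zero, sub_zero, inner_sub_right,
      inner_smul_right]
    ring
  have h3 : ‖inner ℂ (u - inner ℂ w u • w) (v - inner ℂ w v • w)‖ ≤ ε₁ * ε₂ :=
    (norm_inner_le_norm _ _).trans
      (mul_le_mul (hperp u ε₁ h₁ hu hwu) (hperp v ε₂ h₂ hv hwv) (norm_nonneg _) h₁)
  have h4 : ‖inner ℂ u w * inner ℂ w v‖ - ε₁ * ε₂ ≤ ‖inner ℂ u v‖ := by
    have := norm_sub_norm_le (inner ℂ u w * inner ℂ w v)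
      (-inner ℂ (u - inner ℂ w u • w) (v - inner ℂ w v • w))
    rw [sub_neg_eq_add, ← hdec, norm_neg] at this
    linarith
  have hu1 : ‖inner ℂ w u‖ ≤ 1 := (norm_inner_le_norm _ _).trans (by rw [hw, one_mul]; exact hu)
  have hv1 : ‖inner ℂ w v‖ ≤ 1 := (norm_inner_le_norm _ _).trans (by rw [hw, one_mul]; exact hv)
  rw [norm_mul, norm_inner_symm u w] at h4
  set s := ‖inner ℂ w u‖ * ‖inner ℂ w v‖ with hs
  have hs0 : 0 ≤ s := by positivity
  have hs1 : s ≤ 1 := mul_le_one₀ hu1 (norm_nonneg _) hv1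
  have hs2 : (1 - ε₁ ^ 2) * (1 - ε₂ ^ 2) ≤ s ^ 2 := by
    rw [hs, mul_pow]
    exact mul_le_mul hwu hwv (by nlinarith) (sq_nonneg _)
  have he : 0 ≤ ε₁ * ε₂ := mul_nonneg h₁ h₂
  -- Needed in order to square `h4`. It follows from `ε₁ ^ 2 + ε₂ ^ 2 ≤ 1`, a consequence of `ε₁ +
  -- ε₂ ≤ 1`.
  have hse : ε₁ * ε₂ ≤ s := by
    refine abs_le_of_sq_le_sq' ?_ hs0 |>.2
    nlinarith
  have h5 : (s - ε₁ * ε₂) ^ 2 ≤ ‖inner ℂ u v‖ ^ 2 :=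
    pow_le_pow_left₀ (sub_nonneg.2 hse) h4 2
  nlinarith [mul_nonneg he (sub_nonneg.2 hs1), mul_nonneg he he]

/-! ### Purified distance from normalized and pure states. -/

section PurifiedDistance

variable {a : Type*} [Fintype a] [DecidableEq a]

theorem purifiedDist_le_iff {ρ σ : Matrix a a ℂ} {ε : ℝ} (hε : 0 ≤ ε) :
    purifiedDist ρ σ ≤ ε ↔ 1 - ε ^ 2 ≤ genFidelity ρ σ ^ 2 := by
  rw [purifiedDist, Real.sqrt_le_left hε]
  constructor <;> intro h <;> linarith

theorem genFidelity_of_trace_left {ρ σ : Matrix a a ℂ} (h : ρ.trace = 1) :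
    genFidelity ρ σ = fidelity ρ σ := by
  simp [genFidelity, h]

theorem genFidelity_of_trace_right {ρ σ : Matrix a a ℂ} (h : σ.trace = 1) :
    genFidelity ρ σ = fidelity ρ σ := by
  simp [genFidelity, h]

omit [DecidableEq a] in
theorem posSemidef_ketbra (v : a → ℂ) : (ketbra v).PosSemidef :=
  Matrix.posSemidef_vecMulVec_self_star v

omit [DecidableEq a] in
theorem trace_ketbra (v : a → ℂ) : (ketbra v).trace = star v ⬝ᵥ v := by
  rw [ketbra, Matrix.trace_vecMulVec, dotProduct_comm]

theorem psdSqrt_ketbra {v : a → ℂ} (hv : star v ⬝ᵥ v = 1) : psdSqrt (ketbra v) = ketbra v := by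
  refine CFC.sqrt_unique ?_ (posSemidef_ketbra v).nonneg
  rw [ketbra, Matrix.vecMulVec_mul_vecMulVec, hv, one_smul]

end PurifiedDistance

/-! ### Vectors as matrices, and Uhlmann's theorem for discarded registers. -/

section Vectors

/-- The matrix of a vector on a system that is identified with the bipartite system `a ⊗ b`. -/
def unvec {a b ι : Type*} (e : a × b ≃ ι) (u : ι → ℂ) : Matrix a b ℂ :=
  Matrix.of fun i j => u (e (i, j))

theorem trace_unvec {a b ι : Type*} [Fintype a] [Fintype b] [Fintype ι] (e : a × b ≃ ι)
    (u v : ι → ℂ) : ((unvec e u)ᴴ * unvec e v).trace = star u ⬝ᵥ v := by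
  rw [dotProduct, ← e.sum_comp, Fintype.sum_prod_type_right]
  rfl

theorem trace_unvec_mul_conjTranspose {a b ι : Type*} [Fintype a] [Fintype b] [Fintype ι]
    (e : a × b ≃ ι) (u : ι → ℂ) : (unvec e u * (unvec e u)ᴴ).trace = star u ⬝ᵥ u := by
  rw [Matrix.trace_mul_comm, trace_unvec]

theorem inner_toLp {ι : Type*} [Fintype ι] (u v : ι → ℂ) :
    inner ℂ (WithLp.toLp 2 u : EuclideanSpace ℂ ι) (WithLp.toLp 2 v) = star u ⬝ᵥ v := by
  rw [EuclideanSpace.inner_toLp_toLp, dotProduct_comm]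

theorem star_dotProduct_self {ι : Type*} [Fintype ι] (u : ι → ℂ) :
    star u ⬝ᵥ u = ((‖(WithLp.toLp 2 u : EuclideanSpace ℂ ι)‖ ^ 2 : ℝ) : ℂ) := by
  rw [← inner_toLp, inner_self_eq_norm_sq_to_K]
  simp

/-- The tensor product of a vector with a vector on the registers to be discarded. -/
def attach {x y r d e : Type*} (φ : x × y × r → ℂ) (χ : d × e → ℂ) :
    (x × d) × (y × e) × r → ℂ :=
  fun ((i, k), (j, l), s) => φ (i, j, s) * χ (k, l)

variable {x y r d e : Type*} [Fintype x] [Fintype y] [Fintype r] [Fintype d] [Fintype e]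

theorem star_attach_dotProduct (φ φ' : x × y × r → ℂ) (χ χ' : d × e → ℂ) :
    star (attach φ χ) ⬝ᵥ attach φ' χ' = (star φ ⬝ᵥ φ') * (star χ ⬝ᵥ χ') := by
  let σ : (x × y × r) × d × e ≃ (x × d) × (y × e) × r :=
    { toFun := fun ((i, j, s), k, l) => ((i, k), (j, l), s)
      invFun := fun ((i, k), (j, l), s) => ((i, j, s), k, l)
      left_inv := fun _ => rfl
      right_inv := fun _ => rfl }
  rw [dotProduct, ← σ.sum_comp, dotProduct, dotProduct, Finset.sum_mul_sum, Fintype.sum_prod_type]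
  refine Finset.sum_congr rfl fun _ _ => Finset.sum_congr rfl fun _ _ => ?_
  simp only [attach, σ, Equiv.coe_fn_mk, Pi.star_apply, star_mul']
  ring

variable [DecidableEq x] [DecidableEq y] [DecidableEq r] [DecidableEq d] [DecidableEq e]

open scoped Matrix.Norms.L2Operator in
/-- If a partial trace of `Ω` has fidelity `F > 0` with a unit vector `φ`, then `Ω` has overlap at
least `F` with a product of `φ` and a unit vector. -/
theorem exists_attach_of_fidelity (Ω : (x × d) × (y × e) × r → ℂ) {φ : x × y × r → ℂ}
    (hφ : star φ ⬝ᵥ φ = 1) (hF : 0 < fidelity (discard (ketbra Ω)) (ketbra φ)) :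
    ∃ χ : d × e → ℂ, star χ ⬝ᵥ χ = 1 ∧
      fidelity (discard (ketbra Ω)) (ketbra φ) ≤ ‖star Ω ⬝ᵥ attach φ χ‖ := by
  let σ : (x × y × r) × d × e ≃ (x × d) × (y × e) × r :=
    { toFun := fun ((i, j, s), k, l) => ((i, k), (j, l), s)
      invFun := fun ((i, k), (j, l), s) => ((i, j, s), k, l)
      left_inv := fun _ => rfl
      right_inv := fun _ => rfl }
  have hX : unvec σ Ω * (unvec σ Ω)ᴴ = discard (ketbra Ω) := by
    ext ⟨i, j, s⟩ ⟨i', j', s'⟩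
    rw [Matrix.mul_apply, Fintype.sum_prod_type]
    rfl
  obtain ⟨Z, hZ, hZt⟩ := exists_trace_eq_fidelity (unvec σ Ω) (ketbra φ)
  rw [hX, psdSqrt_ketbra hφ] at hZt
  set F := fidelity (discard (ketbra Ω)) (ketbra φ)
  set χ : d × e → ℂ := star φ ᵥ* Z with hχ
  have hov : star Ω ⬝ᵥ attach φ χ = F := by
    have : unvec σ (attach φ χ) = ketbra φ * Z := by
      rw [ketbra, Matrix.vecMulVec_mul]
      rfl
    rw [← hZt, ← trace_unvec σ, this]
  have hn : ‖(WithLp.toLp 2 χ : EuclideanSpace ℂ _)‖ ≤ 1 := by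
    have h1 : ‖(WithLp.toLp 2 (star φ) : EuclideanSpace ℂ _)‖ ^ 2 = 1 := by
      have := star_dotProduct_self (star φ)
      rw [star_star, dotProduct_comm, hφ] at this
      exact_mod_cast this.symm
    have h2 : ‖(WithLp.toLp 2 (star φ) : EuclideanSpace ℂ _)‖ = 1 :=
      (pow_eq_one_iff_of_nonneg (norm_nonneg _) two_ne_zero).1 h1
    rw [hχ, ← Matrix.mulVec_transpose]
    refine (Matrix.l2_opNorm_mulVec Zᵀ (WithLp.toLp 2 (star φ))).trans ?_
    rw [h2, mul_one]
    exact (norm_transpose_le Z).trans hZ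
  set n := ‖(WithLp.toLp 2 χ : EuclideanSpace ℂ _)‖ with hndef
  -- As `0 < n ≤ 1`, rescaling `χ` to a unit vector can only increase the overlap.
  have hn0 : 0 < n := by
    refine (norm_nonneg _).lt_of_ne' fun h => hF.ne' ?_
    have hχ0 : χ = 0 := by simpa using h
    have : (F : ℂ) = 0 := by
      rw [← hov, hχ0]
      exact Finset.sum_eq_zero fun z _ => by simp [attach]
    exact_mod_cast this
  have hatt : attach φ (((n⁻¹ : ℝ) : ℂ) • χ) = ((n⁻¹ : ℝ) : ℂ) • attach φ χ := by
    ext ⟨⟨i, k⟩, ⟨j, l⟩, s⟩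
    simp only [attach, Pi.smul_apply, smul_eq_mul]
    ring
  refine ⟨((n⁻¹ : ℝ) : ℂ) • χ, ?_, ?_⟩
  · rw [star_smul, smul_dotProduct, dotProduct_smul, star_dotProduct_self, ← hndef]
    simp only [smul_eq_mul, RCLike.star_def, Complex.conj_ofReal]
    rw [← Complex.ofReal_mul, ← Complex.ofReal_mul]
    norm_cast
    field_simp
  · rw [hatt, dotProduct_smul, hov, smul_eq_mul, ← Complex.ofReal_mul, Complex.norm_real,
      Real.norm_of_nonneg (by positivity)]
    exact le_mul_of_one_le_left hF.le ((one_le_inv₀ hn0).2 hn)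

end Vectors

/-! ### Redistribution: marginals of input and target, and the pulled-back smoothing. -/

section Redistribution

variable {A B C R : Type} [Fintype A] [DecidableEq A] [Fintype B] [DecidableEq B]
  [Fintype C] [DecidableEq C] [Fintype R] [DecidableEq R]

/-- The vector of `inputState`. -/
def inputVec (K : ℕ) (ψ : (A × B × C) × R → ℂ) : (A × C × Fin K) × (B × Fin K) × R → ℂ :=
  fun ((i, k, s), (j, t), z) => maxEntangled K (s, t) * ψ ((i, j, k), z)

/-- The vector of `targetState`. -/
def targetVec (L : ℕ) (ψ : (A × B × C) × R → ℂ) : (A × Fin L) × (B × C × Fin L) × R → ℂ :=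
  fun ((i, s), (j, k, t), z) => maxEntangled L (s, t) * ψ ((i, j, k), z)

/-- The bipartition `BC : AR`. -/
def bcEquiv (A B C R : Type) : (B × C) × (A × R) ≃ (A × B × C) × R where
  toFun := fun ((j, k), (i, z)) => ((i, j, k), z)
  invFun := fun ((i, j, k), z) => ((j, k), (i, z))
  left_inv := fun _ => rfl
  right_inv := fun _ => rfl

/-- The bipartition that separates the subsystem `y` of the second party from everything else. -/
def sndEquiv (x y k r : Type) : y × (k × (x × r)) ≃ x × (y × k) × r where
  toFun := fun (j, t, i, z) => (i, (j, t), z)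
  invFun := fun (i, (j, t), z) => (j, t, i, z)
  left_inv := fun _ => rfl
  right_inv := fun _ => rfl

theorem maxEntangled_mul_star (K : ℕ) (s t : Fin K) (p q : ℂ) :
    maxEntangled K (s, t) * p * star (maxEntangled K (s, t) * q) =
      if s = t then (K : ℂ)⁻¹ * (p * star q) else 0 := by
  have h : ((1 / √(K : ℝ) : ℝ) : ℂ) * ((1 / √(K : ℝ) : ℝ) : ℂ) = (K : ℂ)⁻¹ := by
    rw [← Complex.ofReal_mul, div_mul_div_comm, Real.mul_self_sqrt (Nat.cast_nonneg K)]
    simp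
  rw [maxEntangled]
  split_ifs
  · rw [star_mul', RCLike.star_def, Complex.conj_ofReal, ← h]
    ring
  · simp

omit [DecidableEq A] [DecidableEq B] [DecidableEq C] [DecidableEq R] in
theorem star_targetVec_dotProduct {L : ℕ} (hL : 1 ≤ L) (ψ ψ' : (A × B × C) × R → ℂ) :
    star (targetVec L ψ) ⬝ᵥ targetVec L ψ' = star ψ ⬝ᵥ ψ' := by
  have hL0 : (L : ℂ) ≠ 0 := by exact_mod_cast (by omega : L ≠ 0)
  have h : ∀ (i : A) (j : B) (k : C) (z : R) (s t : Fin L),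
      star (maxEntangled L (s, t) * ψ ((i, j, k), z)) * (maxEntangled L (s, t) * ψ' ((i, j, k), z))
      = if s = t then (L : ℂ)⁻¹ * (ψ' ((i, j, k), z) * star (ψ ((i, j, k), z))) else 0 := by
    intro i j k z s t
    rw [mul_comm, maxEntangled_mul_star]
  simp only [dotProduct, Fintype.sum_prod_type, Pi.star_apply, targetVec, h]
  refine Finset.sum_congr rfl fun i _ => ?_
  rw [Finset.sum_comm]
  refine Finset.sum_congr rfl fun j _ => ?_
  rw [Finset.sum_comm]
  refine Finset.sum_congr rfl fun k _ => ?_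
  simp only [← Finset.sum_comm (s := (Finset.univ : Finset R))]
  refine Finset.sum_congr rfl fun z _ => ?_
  simp only [Finset.sum_ite_eq, Finset.mem_univ, if_true, Finset.sum_const, Finset.card_univ,
    Fintype.card_fin, nsmul_eq_mul]
  rw [mul_inv_cancel_left₀ hL0, mul_comm]

omit [DecidableEq A] [Fintype B] [DecidableEq B] [Fintype C] [DecidableEq C] [DecidableEq R] in
theorem unvec_bcEquiv_mul_conjTranspose {ψ : (A × B × C) × R → ℂ}
    {ρ : Matrix (A × B × C) (A × B × C) ℂ} (hψ : IsPurification ψ ρ) :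
    unvec (bcEquiv A B C R) ψ * (unvec (bcEquiv A B C R) ψ)ᴴ = traceLeft ρ := by
  rw [← show traceRight (ketbra ψ) = ρ from hψ]
  ext ⟨j, k⟩ ⟨j', k'⟩
  rw [Matrix.mul_apply, Fintype.sum_prod_type]
  rfl

omit [DecidableEq A] [Fintype B] [DecidableEq B] [DecidableEq C] [DecidableEq R] in
theorem unvec_sndEquiv_mul_conjTranspose {K : ℕ} (hK : 1 ≤ K) {ψ : (A × B × C) × R → ℂ}
    {ρ : Matrix (A × B × C) (A × B × C) ℂ} (hψ : IsPurification ψ ρ) :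
    unvec (sndEquiv (A × C × Fin K) B (Fin K) R) (inputVec K ψ) *
      (unvec (sndEquiv (A × C × Fin K) B (Fin K) R) (inputVec K ψ))ᴴ =
      traceRight (traceLeft ρ) := by
  have hK0 : (K : ℂ) ≠ 0 := by exact_mod_cast (by omega : K ≠ 0)
  rw [← show traceRight (ketbra ψ) = ρ from hψ]
  ext j j'
  simp only [Matrix.mul_apply, Fintype.sum_prod_type, Matrix.conjTranspose_apply, unvec,
    Matrix.of_apply, sndEquiv, Equiv.coe_fn_mk, inputVec, maxEntangled_mul_star, traceRight,
    traceLeft, ketbra, Matrix.vecMulVec_apply, Pi.star_apply]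
  rw [Finset.sum_comm, Finset.sum_comm (s := (Finset.univ : Finset C))]
  refine Finset.sum_congr rfl fun i _ => ?_
  rw [Finset.sum_comm]
  refine Finset.sum_congr rfl fun k _ => ?_
  simp only [← Finset.sum_comm (s := (Finset.univ : Finset R))]
  refine Finset.sum_congr rfl fun z _ => ?_
  simp only [Finset.sum_ite_eq', Finset.mem_univ, if_true, Finset.sum_const, Finset.card_univ,
    Fintype.card_fin, nsmul_eq_mul]
  rw [mul_inv_cancel_left₀ hK0]

theorem trace_traceLeft {a b : Type*} [Fintype a] [Fintype b] (ρ : Matrix (a × b) (a × b) ℂ) :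
    (traceLeft ρ).trace = ρ.trace := by
  simp only [Matrix.trace, Matrix.diag, traceLeft, Matrix.of_apply, Fintype.sum_prod_type]
  exact Finset.sum_comm

theorem trace_traceRight {a b : Type*} [Fintype a] [Fintype b] (ρ : Matrix (a × b) (a × b) ℂ) :
    (traceRight ρ).trace = ρ.trace := by
  simp only [Matrix.trace, Matrix.diag, traceRight, Matrix.of_apply, Fintype.sum_prod_type]

open scoped Matrix.Norms.L2Operator

/-- Source of the term `- log L`. The matrix is a reindexed `Y ⊗ N ⊗ X`, where the maximally
entangled factor `N` has norm at most `1 / √L` and `X` has Frobenius norm 1. -/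
theorem norm_sndMat_attach_targetVec_sq_le {L d e : ℕ} (hL : 1 ≤ L) (ψ : (A × B × C) × R → ℂ)
    {χ : Fin d × Fin e → ℂ} (hχ : star χ ⬝ᵥ χ = 1) :
    ‖sndMat (attach (targetVec L ψ) χ)‖ ^ 2 ≤ ‖unvec (bcEquiv A B C R) ψ‖ ^ 2 / L := by
  set Y := unvec (bcEquiv A B C R) ψ with hY
  set X : Matrix (Fin e) (Fin d) ℂ := Matrix.of fun l k => χ (k, l) with hXdef
  set N : Matrix (Fin L) (Fin L) ℂ := ((1 / √(L : ℝ) : ℝ) : ℂ) • 1 with hN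
  have hX : ‖X‖ ≤ 1 := by
    have h1 : ‖X‖ ^ 2 ≤ 1 := by
      refine (norm_sq_le_sum X).trans_eq ?_
      have h2 := star_dotProduct_self χ
      rw [hχ, EuclideanSpace.norm_sq_eq, Fintype.sum_prod_type_right] at h2
      exact_mod_cast h2.symm
    nlinarith [norm_nonneg X]
  have hN1 : ‖N‖ ≤ 1 / √(L : ℝ) := by
    rw [hN, norm_smul, Complex.norm_real, Real.norm_of_nonneg (by positivity)]
    exact mul_le_of_le_one_right (by positivity) norm_one_le
  have h : sndMat (attach (targetVec L ψ) χ) = ((Y ⊗ₖ N) ⊗ₖ X).submatrix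
      (fun p : (B × C × Fin L) × Fin e => (((p.1.1, p.1.2.1), p.1.2.2), p.2))
      (fun q : ((A × Fin L) × Fin d) × R => (((q.1.1.1, q.2), q.1.1.2), q.1.2)) := by
    ext ⟨⟨j, k, t⟩, l⟩ ⟨⟨⟨i, s⟩, m⟩, z⟩
    simp only [sndMat, attach, targetVec, maxEntangled, Matrix.of_apply, Matrix.submatrix_apply,
      Matrix.kroneckerMap_apply, hN, hXdef, hY, unvec, bcEquiv, Equiv.coe_fn_mk, Matrix.smul_apply,
      Matrix.one_apply, smul_eq_mul, mul_ite, mul_one, mul_zero, eq_comm (a := t)]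
    split_ifs <;> ring
  have h1 : ‖sndMat (attach (targetVec L ψ) χ)‖ ≤ ‖Y‖ * (1 / √(L : ℝ)) := by
    rw [h]
    refine (norm_submatrix_le _ ?_ ?_).trans ?_
    · rintro ⟨⟨j, k, t⟩, l⟩ ⟨⟨j', k', t'⟩, l'⟩ h
      simp_all
    · rintro ⟨⟨⟨i, s⟩, m⟩, z⟩ ⟨⟨⟨i', s'⟩, m'⟩, z'⟩ h
      simp_all
    · refine (norm_kronecker_le _ _).trans ((mul_le_of_le_one_right (norm_nonneg _) hX).trans ?_)
      exact (norm_kronecker_le _ _).trans (mul_le_mul_of_nonneg_left hN1 (norm_nonneg _))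
  refine (pow_le_pow_left₀ (norm_nonneg _) h1 2).trans_eq ?_
  rw [mul_pow, div_pow, Real.sq_sqrt (Nat.cast_nonneg L), one_pow, mul_one_div]

variable {M K L : ℕ}

/-- A state close to `ρ^{BC}` with bounded operator norm yields, through a redistribution protocol,
a state close to `ρ^B` whose operator norm is larger at most by the factor given by the resources
that the protocol consumes. -/
theorem RedistProtocol.exists_mem_epsBall {ρ : Matrix (A × B × C) (A × B × C) ℂ}
    (hρ : IsState ρ) {ψ : (A × B × C) × R → ℂ} (hψ : IsPurification ψ ρ) {ε₁ ε₂ : ℝ}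
    (hε₁ : 0 < ε₁) (hε₂ : 0 < ε₂) (hε : ε₁ + ε₂ < 1) (hK : 1 ≤ K) (hL : 1 ≤ L)
    (P : RedistProtocol M A B C K L) (hP : P.IsRedistribution ψ ε₁)
    {σ : Matrix (B × C) (B × C) ℂ} (hσ : σ ∈ epsBall ε₂ (traceLeft ρ)) {l : ℝ}
    (hl : σ ≤ ((2 : ℝ) ^ l) • (1 : Matrix (B × C) (B × C) ℂ)) :
    ∃ τ ∈ epsBall (ε₁ + ε₂) (traceRight (traceLeft ρ)),
      τ ≤ ((2 : ℝ) ^ (l + (P.netEnt + (P.qccAB + P.qccBA)))) • (1 : Matrix B B ℂ) := by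
  obtain ⟨⟨hσpos, hσtr⟩, hσd⟩ := hσ
  have hρBC := unvec_bcEquiv_mul_conjTranspose hψ
  have hρB := unvec_sndEquiv_mul_conjTranspose hK hψ
  have htrBC : (traceLeft ρ).trace = 1 := (trace_traceLeft ρ).trans hρ.2
  have htrB : (traceRight (traceLeft ρ)).trace = 1 := (trace_traceRight _).trans htrBC
  have hψ1 : star ψ ⬝ᵥ ψ = 1 := by rw [← trace_unvec_mul_conjTranspose (bcEquiv A B C R), hρBC, htrBC]
  have hΩ1 : star (inputVec K ψ) ⬝ᵥ inputVec K ψ = 1 := by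
    rw [← trace_unvec_mul_conjTranspose (sndEquiv (A × C × Fin K) B (Fin K) R), hρB, htrB]
  have hφ1 : star (targetVec L ψ) ⬝ᵥ targetVec L ψ = 1 := by
    rw [star_targetVec_dotProduct hL, hψ1]
  -- the smoothing vector on `ABCR`
  obtain ⟨Z, hZ, hZt⟩ := exists_trace_eq_fidelity (unvec (bcEquiv A B C R) ψ) σ
  rw [hρBC] at hZt
  set ψ' : (A × B × C) × R → ℂ := fun w =>
    (psdSqrt σ * Z) ((bcEquiv A B C R).symm w).1 ((bcEquiv A B C R).symm w).2 with hψ'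
  have hY : unvec (bcEquiv A B C R) ψ' = psdSqrt σ * Z := rfl
  have hov' : star ψ ⬝ᵥ ψ' = (fidelity (traceLeft ρ) σ : ℂ) := by
    rw [← trace_unvec (bcEquiv A B C R), hY, hZt]
  have hψ'1 : (star ψ' ⬝ᵥ ψ').re ≤ 1 := by
    rw [← trace_unvec_mul_conjTranspose (bcEquiv A B C R), hY]
    exact (trace_psdSqrt_mul_le hσpos hZ).trans hσtr
  have hYn : ‖unvec (bcEquiv A B C R) ψ'‖ ^ 2 ≤ (2 : ℝ) ^ l := by
    rw [hY]
    refine (pow_le_pow_left₀ (norm_nonneg _) (norm_mul_le_of_contraction_right _ hZ) 2).trans ?_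
    rw [norm_psdSqrt_sq hσpos]
    exact norm_le_of_le_smul_one hσpos (by positivity) hl
  rw [purifiedDist_le_iff hε₂.le, genFidelity_of_trace_left htrBC] at hσd
  -- the output of the protocol
  obtain ⟨d, e, Ω', hch, hΩ', hpull⟩ := Protocol.exists_dilation P (inputVec K ψ)
  rw [hΩ1] at hΩ'
  have hP' : purifiedDist (discard (ketbra Ω')) (ketbra (targetVec L ψ)) ≤ ε₁ := hch ▸ hP
  rw [purifiedDist_le_iff hε₁.le,
    genFidelity_of_trace_right ((trace_ketbra _).trans hφ1)] at hP'
  have hF0 : 0 < fidelity (discard (ketbra Ω')) (ketbra (targetVec L ψ)) := by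
    refine (fidelity_nonneg _ _).lt_of_ne' fun h => ?_
    rw [h] at hP'
    nlinarith
  obtain ⟨χ, hχ, hFχ⟩ := exists_attach_of_fidelity Ω' hφ1 hF0
  set t := attach (targetVec L ψ') χ with ht
  set T := attach (targetVec L ψ) χ with hT
  have hTT : ‖(WithLp.toLp 2 T : EuclideanSpace ℂ _)‖ = 1 := by
    have := star_dotProduct_self T
    rw [hT, star_attach_dotProduct, hφ1, hχ, one_mul] at this
    exact (pow_eq_one_iff_of_nonneg (norm_nonneg _) two_ne_zero).1 (by exact_mod_cast this.symm)
  have htt : ‖(WithLp.toLp 2 t : EuclideanSpace ℂ _)‖ ≤ 1 := by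
    have h1 := star_dotProduct_self t
    rw [ht, star_attach_dotProduct, hχ, mul_one, star_targetVec_dotProduct hL] at h1
    rw [h1, Complex.ofReal_re] at hψ'1
    nlinarith [norm_nonneg (WithLp.toLp 2 t : EuclideanSpace ℂ _)]
  have hΩn : ‖(WithLp.toLp 2 Ω' : EuclideanSpace ℂ _)‖ = 1 := by
    have := star_dotProduct_self Ω'
    rw [hΩ'] at this
    exact (pow_eq_one_iff_of_nonneg (norm_nonneg _) two_ne_zero).1 (by exact_mod_cast this.symm)
  -- The intermediate unit vector is `T`: it is `ε₁`-close to the true output `Ω'` and `ε₂`-close to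
  -- the smoothed target `t`.
  have hov : 1 - (ε₁ + ε₂) ^ 2 ≤ ‖star Ω' ⬝ᵥ t‖ ^ 2 := by
    rw [← inner_toLp]
    refine one_sub_sq_le_norm_inner_sq hTT hΩn.le htt hε₁.le hε₂.le hε.le ?_ ?_
    · rw [norm_inner_symm, inner_toLp]
      exact hP'.trans (pow_le_pow_left₀ hF0.le hFχ 2)
    · rw [inner_toLp, hT, ht, star_attach_dotProduct, hχ, mul_one, star_targetVec_dotProduct hL,
        hov', Complex.norm_real, Real.norm_eq_abs, sq_abs]
      exact hσd
  have hne : star Ω' ⬝ᵥ t ≠ 0 := by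
    intro h
    rw [h, norm_zero] at hov
    nlinarith
  -- pulling back through the protocol
  obtain ⟨t₀, hov₀, hn₀, -, hs₀⟩ := hpull t hne
  set S := unvec (sndEquiv (A × C × Fin K) B (Fin K) R) t₀ with hS
  -- Source of the term `log K`: Bob's half of `Φ_K` moves from the rows to the columns, leaving
  -- only `B`.
  have hSn : ‖S‖ ^ 2 ≤ K * ‖sndMat t₀‖ ^ 2 :=
    norm_sq_unstack_le (T := sndMat t₀) (R := S) (Equiv.refl _) fun _ _ _ => rfl
  have hbound : ‖S‖ ^ 2 ≤ (2 : ℝ) ^ (l + (P.netEnt + (P.qccAB + P.qccBA))) := by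
    have hK0 : (0 : ℝ) < K := by exact_mod_cast hK
    have hL0 : (0 : ℝ) < L := by exact_mod_cast hL
    have h1 := (norm_sndMat_attach_targetVec_sq_le hL ψ' hχ).trans
      (div_le_div_of_nonneg_right hYn hL0.le)
    have h2 : (2 : ℝ) ^ (l + (P.netEnt + (P.qccAB + P.qccBA))) =
        K * ((2 : ℝ) ^ (P.commCost.1 + P.commCost.2) * ((2 : ℝ) ^ l / L)) := by
      rw [Real.rpow_add two_pos, Real.rpow_add two_pos, netEnt, Real.rpow_sub two_pos,
        Real.rpow_logb two_pos (by norm_num) hK0, Real.rpow_logb two_pos (by norm_num) hL0,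
        qccAB, qccBA]
      ring
    rw [h2]
    refine hSn.trans (mul_le_mul_of_nonneg_left (hs₀.trans ?_) hK0.le)
    exact mul_le_mul_of_nonneg_left h1 (by positivity)
  have hSpos := Matrix.posSemidef_self_mul_conjTranspose S
  refine ⟨S * Sᴴ, ⟨⟨hSpos, ?_⟩, ?_⟩,
    le_norm_smul_one hSpos ((norm_sq_eq_norm_mul_conjTranspose S).ge.trans hbound)⟩
  · rw [hS, trace_unvec_mul_conjTranspose, star_dotProduct_self, Complex.ofReal_re]
    exact pow_le_one₀ (norm_nonneg _) (hn₀.trans htt)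
  · rw [purifiedDist_le_iff (by positivity), genFidelity_of_trace_left htrB, ← hρB]
    refine hov.trans (pow_le_pow_left₀ (norm_nonneg _) ?_ 2)
    rw [← hov₀, ← trace_unvec (sndEquiv (A × C × Fin K) B (Fin K) R)]
    exact norm_trace_conjTranspose_mul_le_fidelity _ _

end Redistribution

/-! ### From operator bounds to smooth min-entropies. -/

/-- If every smoothing of `ρ` bounded by `2 ^ l` yields a smoothing of `σ` bounded by
`2 ^ (l + c)`, then the smooth min-entropies differ by at most `c`. -/
theorem smoothMinEntropy_sub_le {a b : Type*} [Fintype a] [DecidableEq a] [Fintype b]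
    [DecidableEq b] {ρ : Matrix a a ℂ} {σ : Matrix b b ℂ} {ε ε' c : ℝ}
    (h : ∀ ρ' ∈ epsBall ε ρ, ∀ l : ℝ, ρ' ≤ ((2 : ℝ) ^ l) • (1 : Matrix a a ℂ) →
      ∃ τ ∈ epsBall ε' σ, τ ≤ ((2 : ℝ) ^ (l + c)) • (1 : Matrix b b ℂ)) :
    smoothMinEntropy ε ρ - smoothMinEntropy ε' σ ≤ (c : EReal) := by
  refine EReal.sub_le_of_le_add' (iSup₂_le fun ρ' hρ' => ?_)
  -- Every admissible `l` is treated separately, so the infimum need not be attained; this includes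
  -- `ρ' = 0`, whose min-entropy is `⊤`.
  refine EReal.neg_le.1 (le_iInf₂ fun l hl => EReal.neg_le.1 ?_)
  obtain ⟨τ, hτ, hτl⟩ := h ρ' hρ' l hl
  have hD : Dmax τ 1 ≤ (l + c : ℝ) := iInf₂_le (l + c) hτl
  have h1 : (-(l + c : ℝ) : EReal) ≤ smoothMinEntropy ε' σ :=
    (EReal.neg_le_neg_iff.2 hD).trans (le_iSup₂ (f := fun τ _ => minEntropy τ) τ hτ)
  have h2 : (-(l : EReal)) = (-(l + c : ℝ) : EReal) + (c : EReal) := by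
    rw [← EReal.coe_neg, ← EReal.coe_neg, ← EReal.coe_add]
    congr 1
    ring
  rw [h2]
  exact add_le_add_left h1 _

end QSR

end

theorem mainTheorem8 {A B C R : Type} [Fintype A] [DecidableEq A] [Fintype B] [DecidableEq B]
    [Fintype C] [DecidableEq C] [Fintype R] [DecidableEq R]
    (ρ : Matrix (A × B × C) (A × B × C) ℂ) (hρ : QSR.IsState ρ)
    (ψ : (A × B × C) × R → ℂ) (hψ : QSR.IsPurification ψ ρ)
    (ε₁ ε₂ : ℝ) (hε₁ : ε₁ ∈ Set.Ioo (0 : ℝ) 1) (hε₂ : ε₂ ∈ Set.Ioo (0 : ℝ) (1 - ε₁))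
    (M K L : ℕ) (hK : 1 ≤ K) (hL : 1 ≤ L) (P : QSR.RedistProtocol M A B C K L)
    (hP : P.IsRedistribution ψ ε₁) :
    QSR.smoothMinEntropy ε₂ (QSR.traceLeft ρ) -
        QSR.smoothMinEntropy (ε₁ + ε₂) (QSR.traceRight (QSR.traceLeft ρ)) ≤
      ((P.netEnt + (P.qccAB + P.qccBA) : ℝ) : EReal) :=
  QSR.smoothMinEntropy_sub_le fun _ hσ _ hl =>
    P.exists_mem_epsBall hρ hψ hε₁.1 hε₂.1 (by linarith [hε₂.2]) hK hL hP hσ hl
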